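/- Let $d\ge 2$, $\eta=e^{2\pi i/d}$. Consider matrix bifactorisations of $W=x^d$ over $\mathbb{C}[x]$: $\mathbb{Z}_2$-graded $\mathbb{C}[x]$-bimodules with an odd bilinear twisted differential whose square is $x^d\cdot 1-1\cdot x^d$, graded by $R$-charge (the variable has degree $2/d$, the differential degree $1$). Morphisms are even bilinear chain maps of $R$-charge $0$ up to homotopy; tensor products are over the middle variable, with differential $D\otimes 1+1\otimes D$ (Koszul signs). For $S\subset\mathbb{Z}_d$ let $P_S$ have even and odd part $\mathbb{C}[x,y]$, differential $\prod_{j\in S}(x-\eta^jy)$ from odd to even and $(x^d-y^d)/\prod_{j\in S}(x-\eta^jy)$ from even to odd, and even generator of charge $(1-|S|)/d$. Write $P_{m;l}=P_{\{m,\dots,m+l\}}$, $\underline a=P_{a;0}$, $\mathbb{I}=P_{0;0}$. The unitors are $\lambda(f(x,y)\otimes p)=f(x,x).p$ and $\rho(p\otimes f(x,y))=p.f(y,y)$, both zero on the odd summand of $\mathbb I$. Let ${}_a(P_S)_b$ be $P_S$ with $x$ acting on the left as $\eta^{-a}x$ and on the right as $\eta^{b}y$, and let $s_{a,b}\colon P_{S-a-b}\to{}_a(P_S)_b$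 be the isomorphism $f(x,y)\mapsto f(\eta^{-a}x,\eta^by)$, multiplied by $\eta^{-|S|a}$ on the odd part. Define $$\psi^L_{a;S}\colon \underline aP_S\xrightarrow{s_{0,-a}\otimes 1}\mathbb I_{-a}P_S=\mathbb I\,{}_{-a}(P_S)\xrightarrow{1\otimes s_{-a,0}^{-1}}\mathbb IP_{S+a}\xrightarrow{\lambda}P_{S+a},$$ $$\psi^R_{S;a}\colon P_S\underline a\xrightarrow{1\otimes s_{-a,0}}P_S\,{}_{-a}\mathbb I=(P_S)_{-a}\mathbb I\xrightarrow{s_{0,-a}^{-1}\otimes 1}P_{S+a}\mathbb I\xrightarrow{\rho}P_{S+a},$$ and $\mathrm{ev}_a=\psi^L_{-a;\{a\}}\colon\underline{-a}\,\underline a\to\mathbb I$. Then all $\psi^L_{a;S}$ and $\psi^R_{S;a}$ are isomorphisms. Let $\kappa^L_{a;S}\colon P_S\to\underline a\,P_S\,\underline{-a}$ be the composite of $(\psi^R_{S+a;-a})^{-1}$ and $(\psi^L_{a;S})^{-1}\otimes1$, and let $\kappa^R_{a;S}\colon P_S\to\underline a\,P_S\,\underline{-a}$ be the composite of $(\psi^L_{a;S-a})^{-1}$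 and $1\otimes(\psi^R_{S;-a})^{-1}$. For all $a\in\mathbb{Z}$, $m,m',m''\in\mathbb{Z}_d$, $l,l',l''\in\{0,\dots,d-2\}$ and every morphism $\varphi\colon P_{m;l}\to P_{m';l'}P_{m'';l''}$, $$(1_{\underline a}\otimes\varphi\otimes1_{\underline{-a}})\circ\kappa^L_{a;(m;l)}=\eta^{\frac a2(l-l'-l'')}\,(1\otimes\mathrm{ev}_a\otimes1)\circ(\kappa^L_{a;(m';l')}\otimes\kappa^R_{a;(m'';l'')})\circ\varphi$$ as morphisms $P_{m;l}\to\underline a\,P_{m';l'}P_{m'';l''}\,\underline{-a}$ (associators and unitors suppressed), where $\eta^{t}=e^{2\pi i t/d}$. -/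

import Mathlib

open CategoryTheory
open scoped TensorProduct

namespace LandauGinzburg

noncomputable section

/-! ### Graded matrix bifactorisations of `x ^ d` -/

/-- A graded (matrix) bifactorisation of `W = x ^ d` over `R = ℂ[x]`.

The underlying `R`-`R`-bimodule is a complex vector space with two commuting endomorphisms, the
left action `xl` and the right action `xr` of the variable `x`. The `ℤ/2`-grading is given by its
parity operator `par` (`+1` on the even part, `-1` on the odd part), and the grading by `R`-charge
(in which `x` has degree `2 / d`, `W` has degree `2` and the twisted differential has degree `1`)
by the diagonalisable degree operator `chg`, which is multiplication by `q` on the part of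
degree `q`. The twisted differential is `diff`.

Freeness and finite rank are not asked for, because a tensor product over the middle variable
is not of finite rank. This does not change the morphisms between given bifactorisations. -/
structure Bifact (d : ℕ) where
  carrier : Type
  [addCommGroup : AddCommGroup carrier]
  [module : Module ℂ carrier]
  /-- left multiplication by the variable -/
  xl : Module.End ℂ carrier
  /-- right multiplication by the variable -/
  xr : Module.End ℂ carrier
  /-- parity operator -/
  par : Module.End ℂ carrier
  /-- degree operator of the `R`-charge -/
  chg : Module.End ℂ carrier
  /-- twisted differential -/
  diff : Module.End ℂ carrier
  xl_xr : ∀ m, xl (xr m) = xr (xl m)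
  par_par : ∀ m, par (par m) = m
  par_xl : ∀ m, par (xl m) = xl (par m)
  par_xr : ∀ m, par (xr m) = xr (par m)
  chg_xl : ∀ m, chg (xl m) = xl (chg m) + (2 / d : ℂ) • xl m
  chg_xr : ∀ m, chg (xr m) = xr (chg m) + (2 / d : ℂ) • xr m
  chg_par : ∀ m, chg (par m) = par (chg m)
  chg_diagonalisable : ⨆ q : ℂ, chg.eigenspace q = ⊤
  diff_xl : ∀ m, diff (xl m) = xl (diff m)
  diff_xr : ∀ m, diff (xr m) = xr (diff m)
  diff_par : ∀ m, diff (par m) = -par (diff m)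
  chg_diff : ∀ m, chg (diff m) = diff (chg m) + diff m
  diff_diff : ∀ m, diff (diff m) = (xl ^ d) m - (xr ^ d) m

variable {d : ℕ}

instance : CoeSort (Bifact d) Type := ⟨Bifact.carrier⟩
instance (M : Bifact d) : AddCommGroup M := M.addCommGroup
instance (M : Bifact d) : Module ℂ M := M.module

/-! ### The homotopy category -/

/-- Even, bilinear, charge preserving maps `f` with `δ f = diff ∘ f - f ∘ diff = 0`. -/
def cycles (M N : Bifact d) : Submodule ℂ (M →ₗ[ℂ] N) where
  carrier := {f | (∀ m, f (M.xl m) = N.xl (f m)) ∧ (∀ m, f (M.xr m) = N.xr (f m)) ∧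
    (∀ m, f (M.par m) = N.par (f m)) ∧ (∀ m, f (M.chg m) = N.chg (f m)) ∧
    (∀ m, f (M.diff m) = N.diff (f m))}
  zero_mem' := by simp
  add_mem' := by
    rintro f g ⟨h1, h2, h3, h4, h5⟩ ⟨k1, k2, k3, k4, k5⟩
    refine ⟨?_, ?_, ?_, ?_, ?_⟩ <;> intro m <;> simp_all
  smul_mem' := by
    rintro c f ⟨h1, h2, h3, h4, h5⟩
    refine ⟨?_, ?_, ?_, ?_, ?_⟩ <;> intro m <;> simp_all

/-- The maps `δ h = diff ∘ h + h ∘ diff` with `h` odd, bilinear and of charge `-1`. -/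
def boundaries (M N : Bifact d) : Submodule ℂ (M →ₗ[ℂ] N) where
  carrier := {f | ∃ h : M →ₗ[ℂ] N,
    (∀ m, h (M.xl m) = N.xl (h m)) ∧ (∀ m, h (M.xr m) = N.xr (h m)) ∧
    (∀ m, h (M.par m) = -N.par (h m)) ∧ (∀ m, N.chg (h m) = h (M.chg m) - h m) ∧
    (∀ m, f m = N.diff (h m) + h (M.diff m))}
  zero_mem' := ⟨0, by simp⟩
  add_mem' := by
    rintro f g ⟨h, h1, h2, h3, h4, h5⟩ ⟨k, k1, k2, k3, k4, k5⟩
    refine ⟨h + k, ?_, ?_, ?_, ?_, ?_⟩ <;> intro m <;> simp_all <;> abel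
  smul_mem' := by
    rintro c f ⟨h, h1, h2, h3, h4, h5⟩
    refine ⟨c • h, ?_, ?_, ?_, ?_, ?_⟩ <;> intro m <;> simp_all [smul_sub]

/-- Morphisms of the homotopy category: the degree zero homology of the morphism complex. -/
abbrev HMFHom (M N : Bifact d) : Type :=
  cycles M N ⧸ (boundaries M N).comap (cycles M N).subtype

/-- The homotopy class of a chain map. -/
def homClass {M N : Bifact d} (f : cycles M N) : HMFHom M N := Submodule.Quotient.mk f

theorem homClass_eq {M N : Bifact d} {f g : cycles M N} :
    homClass f = homClass g ↔ (f - g : M →ₗ[ℂ] N) ∈ boundaries M N :=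
  Submodule.Quotient.eq _

/-- Composition of chain maps (in diagrammatic order). -/
def cyclesComp {M N P : Bifact d} (f : cycles M N) (g : cycles N P) : cycles M P :=
  ⟨g.1 ∘ₗ f.1, by
    obtain ⟨f, h1, h2, h3, h4, h5⟩ := f
    obtain ⟨g, k1, k2, k3, k4, k5⟩ := g
    refine ⟨?_, ?_, ?_, ?_, ?_⟩ <;> intro m <;> simp_all⟩

/-- The homotopy category of graded bifactorisations of `x ^ d`. -/
instance : Category (Bifact d) where
  Hom M N := HMFHom M N
  id M := homClass ⟨LinearMap.id, by refine ⟨?_, ?_, ?_, ?_, ?_⟩ <;> simp⟩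
  comp {M N P} := Quotient.map₂ cyclesComp (by
    rintro f f' hf g g' hg
    obtain ⟨h, h1, h2, h3, h4, h5⟩ := homClass_eq.1 (Quotient.sound hf)
    obtain ⟨k, k1, k2, k3, k4, k5⟩ := homClass_eq.1 (Quotient.sound hg)
    refine Quotient.exact (homClass_eq.2 ⟨g.1 ∘ₗ h + k ∘ₗ f'.1, ?_⟩)
    obtain ⟨f, f1, f2, f3, f4, f5⟩ := f
    obtain ⟨f', f1', f2', f3', f4', f5'⟩ := f'
    obtain ⟨g, g1, g2, g3, g4, g5⟩ := g
    obtain ⟨g', g1', g2', g3', g4', g5'⟩ := g'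
    refine ⟨?_, ?_, ?_, ?_, ?_⟩ <;> intro m
    · simp_all
    · simp_all
    · simp_all; abel
    · simp [← g4, k4, h4, f4']; abel
    · have e1 := congrArg g (h5 m)
      have e2 := k5 (f' m)
      simp only [LinearMap.sub_apply, map_add, map_sub, g5, ← f5'] at e1 e2
      simp only [cyclesComp, LinearMap.sub_apply, LinearMap.comp_apply, LinearMap.add_apply,
        map_add]
      calc g (f m) - g' (f' m) = (g (f m) - g (f' m)) + (g (f' m) - g' (f' m)) := by abel
        _ = _ := by rw [e1, e2]; abel)
  id_comp := by rintro M N ⟨f⟩; rfl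
  comp_id := by rintro M N ⟨f⟩; rfl
  assoc := by rintro M N P Q ⟨f⟩ ⟨g⟩ ⟨h⟩; rfl

instance (M N : Bifact d) : AddCommGroup (M ⟶ N) := inferInstanceAs (AddCommGroup (HMFHom M N))
instance (M N : Bifact d) : Module ℂ (M ⟶ N) := inferInstanceAs (Module ℂ (HMFHom M N))

/-- The isomorphism in the homotopy category given by a bijective chain map `f`, with inverse
map `g`. -/
def isoMk {M N : Bifact d} (f : cycles M N) (g : N →ₗ[ℂ] M) (h1 : ∀ m, g (f.1 m) = m)
    (h2 : ∀ n, f.1 (g n) = n) : M ≅ N where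
  hom := homClass f
  inv := homClass ⟨g, by
    obtain ⟨f, f1, f2, f3, f4, f5⟩ := f
    refine ⟨?_, ?_, ?_, ?_, ?_⟩ <;> intro n
    · conv_lhs => rw [← h2 n, ← f1, h1]
    · conv_lhs => rw [← h2 n, ← f2, h1]
    · conv_lhs => rw [← h2 n, ← f3, h1]
    · conv_lhs => rw [← h2 n, ← f4, h1]
    · conv_lhs => rw [← h2 n, ← f5, h1]⟩
  hom_inv_id := congrArg homClass (Subtype.ext (LinearMap.ext h1))
  inv_hom_id := congrArg homClass (Subtype.ext (LinearMap.ext h2))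

/-! ### The tensor product over the middle variable -/

/-- The relations `m x ⊗ n = m ⊗ x n`. -/
def balanced (M N : Bifact d) : Submodule ℂ (M ⊗[ℂ] N) :=
  LinearMap.range (TensorProduct.map M.xr LinearMap.id - TensorProduct.map LinearMap.id N.xl)

/-- The vector space `M ⊗ N` over `ℂ[x]`, using the right action on `M` and the left one on `N`. -/
abbrev BalTensor (M N : Bifact d) : Type := (M ⊗[ℂ] N) ⧸ balanced M N

/-- Pure tensors. -/
def pureTensor (M N : Bifact d) : M →ₗ[ℂ] N →ₗ[ℂ] BalTensor M N :=
  (TensorProduct.mk ℂ M N).compr₂ (balanced M N).mkQ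

theorem pureTensor_balanced (M N : Bifact d) (m : M) (n : N) :
    pureTensor M N (M.xr m) n = pureTensor M N m (N.xl n) :=
  (Submodule.Quotient.eq _).2 ⟨m ⊗ₜ n, by simp⟩

/-- The universal property of the tensor product. -/
def balLift {M N : Bifact d} {Q : Type*} [AddCommGroup Q] [Module ℂ Q] (B : M →ₗ[ℂ] N →ₗ[ℂ] Q)
    (hB : ∀ m n, B (M.xr m) n = B m (N.xl n)) : BalTensor M N →ₗ[ℂ] Q :=
  (balanced M N).liftQ (TensorProduct.lift B) (by
    rintro _ ⟨t, rfl⟩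
    rw [LinearMap.mem_ker]
    induction t with
    | zero => simp
    | tmul m n => simp [hB]
    | add s t hs ht => rw [map_add, map_add, hs, ht, add_zero])

@[simp] theorem balLift_pure {M N : Bifact d} {Q : Type*} [AddCommGroup Q] [Module ℂ Q]
    (B : M →ₗ[ℂ] N →ₗ[ℂ] Q) (hB : ∀ m n, B (M.xr m) n = B m (N.xl n)) (m : M) (n : N) :
    balLift B hB (pureTensor M N m n) = B m n := by
  simp [balLift, pureTensor]

theorem bal_induction {M N : Bifact d} {p : BalTensor M N → Prop}
    (pure : ∀ m n, p (pureTensor M N m n)) (add : ∀ s t, p s → p t → p (s + t)) (t) : p t := by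
  obtain ⟨t, rfl⟩ := Submodule.Quotient.mk_surjective _ t
  induction t with
  | zero => simpa using pure 0 0
  | tmul m n => exact pure m n
  | add s t hs ht => exact add _ _ hs ht

/-- `A ⊗ B` for maps `A` and `B` that are linear over the middle variable. -/
def balMap {M N M' N' : Bifact d} (A : M →ₗ[ℂ] M') (B : N →ₗ[ℂ] N')
    (hA : ∀ m, A (M.xr m) = M'.xr (A m)) (hB : ∀ n, B (N.xl n) = N'.xl (B n)) :
    BalTensor M N →ₗ[ℂ] BalTensor M' N' :=
  balLift ((pureTensor M' N').compl₁₂ A B) (by simp [hA, hB, pureTensor_balanced])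

@[simp] theorem balMap_pure {M N M' N' : Bifact d} (A : M →ₗ[ℂ] M') (B : N →ₗ[ℂ] N')
    (hA : ∀ m, A (M.xr m) = M'.xr (A m)) (hB : ∀ n, B (N.xl n) = N'.xl (B n)) (m : M) (n : N) :
    balMap A B hA hB (pureTensor M N m n) = pureTensor M' N' (A m) (B n) := by
  simp [balMap]

/-- The degree operator of a tensor product: degrees add up. -/
def tensorChg (M N : Bifact d) : Module.End ℂ (BalTensor M N) :=
  balLift ((pureTensor M N) ∘ₗ M.chg + (pureTensor M N).compl₂ N.chg) (by
    intro m n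
    simp [M.chg_xr, N.chg_xl, pureTensor_balanced]
    abel)

/-- The twisted differential `diff ⊗ 1 + 1 ⊗ diff`, with the Koszul sign
`(1 ⊗ diff) (m ⊗ n) = (-1) ^ |m| m ⊗ diff n`. -/
def tensorDiff (M N : Bifact d) : Module.End ℂ (BalTensor M N) :=
  balMap M.diff LinearMap.id M.diff_xr (fun _ => rfl) + balMap M.par N.diff M.par_xr N.diff_xl

@[simp] theorem tensorChg_pure (M N : Bifact d) (m : M) (n : N) :
    tensorChg M N (pureTensor M N m n) =
      pureTensor M N (M.chg m) n + pureTensor M N m (N.chg n) := by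
  simp [tensorChg]

@[simp] theorem tensorDiff_pure (M N : Bifact d) (m : M) (n : N) :
    tensorDiff M N (pureTensor M N m n) =
      pureTensor M N (M.diff m) n + pureTensor M N (M.par m) (N.diff n) := by
  simp [tensorDiff]

theorem pureTensor_balanced_pow (M N : Bifact d) (k : ℕ) (m : M) (n : N) :
    pureTensor M N ((M.xr ^ k) m) n = pureTensor M N m ((N.xl ^ k) n) := by
  induction k generalizing m n with
  | zero => rfl
  | succ k ih => rw [pow_succ', Module.End.mul_apply, pureTensor_balanced, ih, pow_succ,
      Module.End.mul_apply]

theorem balMap_xl_pow (M N : Bifact d) (k : ℕ) (m : M) (n : N) :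
    ((balMap M.xl LinearMap.id M.xl_xr (fun _ => rfl) : Module.End ℂ (BalTensor M N)) ^ k)
      (pureTensor M N m n) = pureTensor M N ((M.xl ^ k) m) n := by
  induction k generalizing m with
  | zero => rfl
  | succ k ih => simp [pow_succ, ih]

theorem balMap_xr_pow (M N : Bifact d) (k : ℕ) (m : M) (n : N) :
    ((balMap LinearMap.id N.xr (fun _ => rfl) (fun n => (N.xl_xr n).symm) :
      Module.End ℂ (BalTensor M N)) ^ k)
      (pureTensor M N m n) = pureTensor M N m ((N.xr ^ k) n) := by
  induction k generalizing n with
  | zero => rfl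
  | succ k ih => simp [pow_succ, ih]

theorem tensorChg_diagonalisable (M N : Bifact d) :
    ⨆ q : ℂ, (tensorChg M N).eigenspace q = ⊤ := by
  rw [eq_top_iff]
  rintro t -
  induction t using bal_induction with
  | add s t hs ht => exact add_mem hs ht
  | pure m n =>
    have hm : m ∈ ⨆ q : ℂ, M.chg.eigenspace q := by rw [M.chg_diagonalisable]; trivial
    have hn : n ∈ ⨆ q : ℂ, N.chg.eigenspace q := by rw [N.chg_diagonalisable]; trivial
    induction hm using Submodule.iSup_induction' with
    | zero => simp
    | add a b _ _ ha hb => rw [map_add]; exact add_mem ha hb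
    | mem p m hm =>
      induction hn using Submodule.iSup_induction' with
      | zero => simp
      | add a b _ _ ha hb => rw [map_add]; exact add_mem ha hb
      | mem q n hn =>
        refine Submodule.mem_iSup_of_mem (p + q) ?_
        rw [Module.End.mem_eigenspace_iff] at hm hn ⊢
        simp [hm, hn, add_smul]

/-- The tensor product of bifactorisations. -/
def tensorObj (M N : Bifact d) : Bifact d where
  carrier := BalTensor M N
  xl := balMap M.xl LinearMap.id M.xl_xr (fun _ => rfl)
  xr := balMap LinearMap.id N.xr (fun _ => rfl) (fun n => (N.xl_xr n).symm)
  par := balMap M.par N.par M.par_xr N.par_xl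
  chg := tensorChg M N
  diff := tensorDiff M N
  xl_xr t := by induction t using bal_induction <;> simp_all
  par_par t := by induction t using bal_induction <;> simp_all [M.par_par, N.par_par]
  par_xl t := by induction t using bal_induction <;> simp_all [M.par_xl]
  par_xr t := by induction t using bal_induction <;> simp_all [N.par_xr]
  chg_xl t := by
    induction t using bal_induction with
    | pure m n => simp [M.chg_xl]; abel
    | add s t hs ht => simp [hs, ht]; abel
  chg_xr t := by
    induction t using bal_induction with
    | pure m n => simp [N.chg_xr]; abel
    | add s t hs ht => simp [hs, ht]; abel
  chg_par t := by
    induction t using bal_induction with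
    | pure m n => simp [N.chg_par, M.chg_par]
    | add s t hs ht => simp [hs, ht]
  chg_diagonalisable := tensorChg_diagonalisable M N
  diff_xl t := by
    induction t using bal_induction with
    | pure m n => simp [M.diff_xl, M.par_xl]
    | add s t hs ht => simp [hs, ht]
  diff_xr t := by
    induction t using bal_induction with
    | pure m n => simp [N.diff_xr]
    | add s t hs ht => simp [hs, ht]
  diff_par t := by
    induction t using bal_induction with
    | pure m n => simp [M.diff_par, N.diff_par, M.par_par]; abel
    | add s t hs ht => simp [hs, ht]; abel
  chg_diff t := by
    induction t using bal_induction with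
    | pure m n => simp [M.chg_diff, N.chg_diff, M.chg_par]; abel
    | add s t hs ht => simp [hs, ht]; abel
  diff_diff t := by
    induction t using bal_induction with
    | pure m n =>
      simp [M.diff_diff, N.diff_diff, M.diff_par, M.par_par, balMap_xl_pow, balMap_xr_pow,
        pureTensor_balanced_pow]
    | add s t hs ht => simp only [map_add, hs, ht]; abel

infixr:70 " ⊙ " => tensorObj

/-- The pure tensor of `m` and `n` in `M ⊙ N`. -/
def tmul {M N : Bifact d} (m : M) (n : N) : (M ⊙ N : Bifact d) := pureTensor M N m n

infixl:75 " ⊗ₚ " => tmul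

section tmul

variable {M N M' N' : Bifact d}

@[simp] theorem add_tmul (m m' : M) (n : N) : (m + m') ⊗ₚ n = m ⊗ₚ n + m' ⊗ₚ n :=
  congrArg (fun f => f n) (map_add (pureTensor M N) m m')
@[simp] theorem tmul_add (m : M) (n n' : N) : m ⊗ₚ (n + n') = m ⊗ₚ n + m ⊗ₚ n' :=
  map_add (pureTensor M N m) n n'
@[simp] theorem sub_tmul (m m' : M) (n : N) : (m - m') ⊗ₚ n = m ⊗ₚ n - m' ⊗ₚ n :=
  congrArg (fun f => f n) (map_sub (pureTensor M N) m m')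
@[simp] theorem tmul_sub (m : M) (n n' : N) : m ⊗ₚ (n - n') = m ⊗ₚ n - m ⊗ₚ n' :=
  map_sub (pureTensor M N m) n n'
@[simp] theorem neg_tmul (m : M) (n : N) : (-m) ⊗ₚ n = -(m ⊗ₚ n) :=
  congrArg (fun f => f n) (map_neg (pureTensor M N) m)
@[simp] theorem tmul_neg (m : M) (n : N) : m ⊗ₚ (-n) = -(m ⊗ₚ n) :=
  map_neg (pureTensor M N m) n
@[simp] theorem smul_tmul (c : ℂ) (m : M) (n : N) : (c • m) ⊗ₚ n = c • (m ⊗ₚ n) :=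
  congrArg (fun f => f n) (map_smul (pureTensor M N) c m)
@[simp] theorem tmul_smul (c : ℂ) (m : M) (n : N) : m ⊗ₚ (c • n) = c • (m ⊗ₚ n) :=
  map_smul (pureTensor M N m) c n
theorem xr_tmul (m : M) (n : N) : M.xr m ⊗ₚ n = m ⊗ₚ N.xl n := pureTensor_balanced M N m n
@[simp] theorem xl_tmul (m : M) (n : N) : (M ⊙ N).xl (m ⊗ₚ n) = M.xl m ⊗ₚ n :=
  balMap_pure (M' := M) (N' := N) M.xl LinearMap.id M.xl_xr (fun _ => rfl) m n
@[simp] theorem tmul_xr (m : M) (n : N) : (M ⊙ N).xr (m ⊗ₚ n) = m ⊗ₚ N.xr n :=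
  balMap_pure (M' := M) (N' := N) LinearMap.id N.xr (fun _ => rfl) (fun n => (N.xl_xr n).symm) m n
@[simp] theorem par_tmul (m : M) (n : N) : (M ⊙ N).par (m ⊗ₚ n) = M.par m ⊗ₚ N.par n :=
  balMap_pure (M' := M) (N' := N) M.par N.par M.par_xr N.par_xl m n
@[simp] theorem chg_tmul (m : M) (n : N) :
    (M ⊙ N).chg (m ⊗ₚ n) = M.chg m ⊗ₚ n + m ⊗ₚ N.chg n := tensorChg_pure M N m n
@[simp] theorem diff_tmul (m : M) (n : N) :
    (M ⊙ N).diff (m ⊗ₚ n) = M.diff m ⊗ₚ n + M.par m ⊗ₚ N.diff n := tensorDiff_pure M N m n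

theorem tensor_induction {p : (M ⊙ N : Bifact d) → Prop} (t : (M ⊙ N : Bifact d))
    (tmul : ∀ m n, p (m ⊗ₚ n)) (add : ∀ s t, p s → p t → p (s + t)) : p t :=
  bal_induction (p := p) tmul add t

/-- Linear maps out of a tensor product. -/
def tensorLift {Q : Type*} [AddCommGroup Q] [Module ℂ Q] (B : M →ₗ[ℂ] N →ₗ[ℂ] Q)
    (hB : ∀ m n, B (M.xr m) n = B m (N.xl n)) : (M ⊙ N : Bifact d) →ₗ[ℂ] Q := balLift B hB

@[simp] theorem tensorLift_tmul {Q : Type*} [AddCommGroup Q] [Module ℂ Q]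
    (B : M →ₗ[ℂ] N →ₗ[ℂ] Q) (hB : ∀ m n, B (M.xr m) n = B m (N.xl n)) (m : M) (n : N) :
    tensorLift B hB (m ⊗ₚ n) = B m n := balLift_pure B hB m n

/-- `A ⊗ B` as a linear map. -/
def tensorMap (A : M →ₗ[ℂ] M') (B : N →ₗ[ℂ] N')
    (hA : ∀ m, A (M.xr m) = M'.xr (A m)) (hB : ∀ n, B (N.xl n) = N'.xl (B n)) :
    (M ⊙ N : Bifact d) →ₗ[ℂ] (M' ⊙ N' : Bifact d) := balMap A B hA hB

@[simp] theorem tensorMap_tmul (A : M →ₗ[ℂ] M') (B : N →ₗ[ℂ] N')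
    (hA : ∀ m, A (M.xr m) = M'.xr (A m)) (hB : ∀ n, B (N.xl n) = N'.xl (B n)) (m : M) (n : N) :
    tensorMap A B hA hB (m ⊗ₚ n) = A m ⊗ₚ B n := balMap_pure A B hA hB m n

/-- `m ↦ n ↦ m ⊗ n` as a bilinear map. -/
def tmulL (M N : Bifact d) : M →ₗ[ℂ] N →ₗ[ℂ] (M ⊙ N : Bifact d) :=
  LinearMap.mk₂ ℂ tmul add_tmul smul_tmul tmul_add tmul_smul

@[simp] theorem tmulL_apply (m : M) (n : N) : tmulL M N m n = m ⊗ₚ n := rfl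

end tmul

/-- The tensor product of chain maps. -/
def cyclesTensor {M M' N N' : Bifact d} (f : cycles M M') (g : cycles N N') :
    cycles (M ⊙ N) (M' ⊙ N') :=
  ⟨tensorMap f.1 g.1 f.2.2.1 g.2.1, by
    obtain ⟨f, f1, f2, f3, f4, f5⟩ := f
    obtain ⟨g, g1, g2, g3, g4, g5⟩ := g
    refine ⟨?_, ?_, ?_, ?_, ?_⟩ <;> intro t <;>
      induction t using tensor_induction with
      | tmul m n => simp [f1, f3, f4, f5, g2, g3, g4, g5]
      | add s t hs ht => simp only [map_add, hs, ht]⟩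

/-- The tensor product of morphisms in the homotopy category. -/
def tensorHom {M M' N N' : Bifact d} : (M ⟶ M') → (N ⟶ N') → (M ⊙ N ⟶ M' ⊙ N') :=
  Quotient.map₂ cyclesTensor (by
    rintro f f' hf g g' hg
    obtain ⟨h, h1, h2, h3, h4, h5⟩ := homClass_eq.1 (Quotient.sound hf)
    obtain ⟨k, k1, k2, k3, k4, k5⟩ := homClass_eq.1 (Quotient.sound hg)
    obtain ⟨f, f1, f2, f3, f4, f5⟩ := f
    obtain ⟨f', f1', f2', f3', f4', f5'⟩ := f'
    obtain ⟨g, g1, g2, g3, g4, g5⟩ := g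
    obtain ⟨g', g1', g2', g3', g4', g5'⟩ := g'
    refine Quotient.exact (homClass_eq.2 ⟨tensorMap h g h2 g1 +
      tensorMap (M'.par ∘ₗ f') k (by simp [f2', M'.par_xr]) k1, ?_⟩)
    simp only [LinearMap.sub_apply] at h5 k5
    refine ⟨?_, ?_, ?_, ?_, ?_⟩ <;> intro t <;> induction t using tensor_induction with
      | add s t hs ht => first
        | simp only [map_add, neg_add, hs, ht]; done
        | simp only [map_add, hs, ht]; abel
      | tmul m n => ?_
    · simp [h1, f1', M'.par_xl]
    · simp [g2, k2]
    · simp [h3, g3, f3', k3]; abel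
    · simp [h4, g4, ← f4', k4, M'.chg_par]; abel
    · have e3 : f m ⊗ₚ g n - f' m ⊗ₚ g' n =
          (M'.diff (h m) ⊗ₚ g n + h (M.diff m) ⊗ₚ g n) +
          (f' m ⊗ₚ N'.diff (k n) + f' m ⊗ₚ k (N.diff n)) := by
        rw [← add_tmul, ← tmul_add, ← h5, ← k5]
        simp
      simp [cyclesTensor, e3, f3', M'.par_par, h3, g5, f5', M'.diff_par]
      abel)

infixr:70 " ⊙ₘ " => tensorHom

/-- The associator. -/
def associator (M N P : Bifact d) : (M ⊙ N) ⊙ P ≅ M ⊙ (N ⊙ P) :=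
  isoMk
    ⟨tensorLift (tensorLift ((LinearMap.llcomp ℂ P (N ⊙ P) (M ⊙ (N ⊙ P))).compl₁₂
        (tmulL M (N ⊙ P)) (tmulL N P))
        (fun m n => by ext p; simp [xr_tmul]))
        (fun t p => by
          induction t using tensor_induction with
          | tmul m n => simp [xr_tmul]
          | add s t hs ht => simp only [map_add, LinearMap.add_apply, hs, ht]), by
      refine ⟨?_, ?_, ?_, ?_, ?_⟩ <;> intro t <;> induction t using tensor_induction with
        | add s t hs ht => simp only [map_add, hs, ht]
        | tmul t p => induction t using tensor_induction with
          | add s t hs ht =>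
            simp only [add_tmul, map_add, hs, ht]
          | tmul m n => simp; try abel⟩
    (tensorLift (tensorLift (((LinearMap.llcomp ℂ M (M ⊙ N) ((M ⊙ N) ⊙ P)).compl₁₂
        (tmulL (M ⊙ N) P).flip (tmulL M N).flip).flip)
        (fun n p => by ext m; simp [← xr_tmul])).flip
        (fun m t => by
          induction t using tensor_induction with
          | tmul n p => simp [xr_tmul]
          | add s t hs ht => simp only [map_add, hs, ht]))
    (fun t => by
      induction t using tensor_induction with
      | add s t hs ht => simp only [map_add, hs, ht]
      | tmul t p => induction t using tensor_induction with
        | add s t hs ht => simp only [add_tmul, map_add, hs, ht]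
        | tmul m n => simp)
    (fun t => by
      induction t using tensor_induction with
      | add s t hs ht => simp only [map_add, hs, ht]
      | tmul m t => induction t using tensor_induction with
        | add s t hs ht => simp only [tmul_add, map_add, hs, ht]
        | tmul n p => simp)

/-! ### Permutation type bifactorisations -/

section perm


/-- `ℂ[x, y]`, where `x` is `X 0` and `y` is `X 1`. -/
abbrev Poly : Type := MvPolynomial (Fin 2) ℂ

/-- The Euler derivation `x ∂/∂x + y ∂/∂y`, which is multiplication by `n` on the homogeneous
polynomials of degree `n`. -/
def euler : Derivation ℂ Poly Poly := MvPolynomial.mkDerivation ℂ MvPolynomial.X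

@[simp] theorem euler_X (i : Fin 2) : euler (MvPolynomial.X i) = MvPolynomial.X i :=
  MvPolynomial.mkDerivation_X _ _ _

@[simp] theorem euler_C (c : ℂ) : euler (MvPolynomial.C c) = 0 :=
  MvPolynomial.derivation_C _ _

theorem euler_monomial (u : Fin 2 →₀ ℕ) (c : ℂ) :
    euler (MvPolynomial.monomial u c) = ((u 0 + u 1 : ℕ) : ℂ) • MvPolynomial.monomial u c := by
  rw [euler, MvPolynomial.mkDerivation_monomial, Finsupp.sum_fintype _ _ (by simp),
    Fin.sum_univ_two, MvPolynomial.smul_monomial]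
  have key : ∀ i : Fin 2, (MvPolynomial.monomial (u - Finsupp.single i 1) (u i : ℂ)) •
      (MvPolynomial.X i : Poly) = MvPolynomial.monomial u (u i : ℂ) := by
    intro i
    rw [smul_eq_mul, MvPolynomial.X, MvPolynomial.monomial_mul, mul_one]
    by_cases h : u i = 0
    · simp [h]
    · rw [tsub_add_cancel_of_le (Finsupp.single_le_iff.2 (Nat.one_le_iff_ne_zero.2 h))]
  rw [key, key, ← map_add, MvPolynomial.smul_monomial]
  congr 1
  simp [mul_comm]

/-- `f (x, y) ↦ f (x, x)`. -/
def diagonal : Poly →ₐ[ℂ] Polynomial ℂ := MvPolynomial.aeval fun _ => Polynomial.X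

/-- The left action of `f (x, x)` on `M`. -/
def actL (M : Bifact d) : Poly →ₗ[ℂ] Module.End ℂ M :=
  ((Polynomial.aeval M.xl).comp diagonal).toLinearMap

/-- The right action of `f (x, x)` on `M`. -/
def actR (M : Bifact d) : Poly →ₗ[ℂ] Module.End ℂ M :=
  ((Polynomial.aeval M.xr).comp diagonal).toLinearMap

@[simp] theorem actL_mul_X (M : Bifact d) (f : Poly) (i : Fin 2) (m : M) :
    actL M (f * MvPolynomial.X i) m = actL M f (M.xl m) := by
  simp [actL, diagonal]
@[simp] theorem actR_mul_X (M : Bifact d) (f : Poly) (i : Fin 2) (m : M) :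
    actR M (f * MvPolynomial.X i) m = actR M f (M.xr m) := by
  simp [actR, diagonal]
@[simp] theorem actL_C (M : Bifact d) (c : ℂ) (m : M) : actL M (MvPolynomial.C c) m = c • m := by
  simp [actL, diagonal, Polynomial.aeval_C]
@[simp] theorem actR_C (M : Bifact d) (c : ℂ) (m : M) : actR M (MvPolynomial.C c) m = c • m := by
  simp [actR, diagonal, Polynomial.aeval_C]

/-- A map that commutes with the left actions commutes with `actL`. -/
theorem actL_comm {M N : Bifact d} (A : M →ₗ[ℂ] N) (hA : ∀ m, A (M.xl m) = N.xl (A m))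
    (f : Poly) (m : M) : actL N f (A m) = A (actL M f m) := by
  induction f using MvPolynomial.induction_on generalizing m with
  | C c => simp
  | add f g hf hg => simp [hf, hg]
  | mul_X f i hf => simp [← hA, hf]

theorem actR_comm {M N : Bifact d} (A : M →ₗ[ℂ] N) (hA : ∀ m, A (M.xr m) = N.xr (A m))
    (f : Poly) (m : M) : actR N f (A m) = A (actR M f m) := by
  induction f using MvPolynomial.induction_on generalizing m with
  | C c => simp
  | add f g hf hg => simp [hf, hg]
  | mul_X f i hf => simp [← hA, hf]

theorem chg_actL (M : Bifact d) (f : Poly) (m : M) :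
    M.chg (actL M f m) = actL M f (M.chg m) + (2 / d : ℂ) • actL M (euler f) m := by
  induction f using MvPolynomial.induction_on generalizing m with
  | C c => simp
  | add f g hf hg => simp [hf, hg]; abel
  | mul_X f i hf => simp [hf, M.chg_xl, mul_comm _ (euler f)]; abel

theorem chg_actR (M : Bifact d) (f : Poly) (m : M) :
    M.chg (actR M f m) = actR M f (M.chg m) + (2 / d : ℂ) • actR M (euler f) m := by
  induction f using MvPolynomial.induction_on generalizing m with
  | C c => simp
  | add f g hf hg => simp [hf, hg]; abel
  | mul_X f i hf => simp [hf, M.chg_xr, mul_comm _ (euler f)]; abel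

/-- `f (x, y) ↦ f (u x, v y)`. -/
def scale (u v : ℂ) : Poly →ₐ[ℂ] Poly :=
  MvPolynomial.aeval ![MvPolynomial.C u * MvPolynomial.X 0, MvPolynomial.C v * MvPolynomial.X 1]

@[simp] theorem scale_X_zero (u v : ℂ) :
    scale u v (MvPolynomial.X 0) = MvPolynomial.C u * MvPolynomial.X 0 := by simp [scale]
@[simp] theorem scale_X_one (u v : ℂ) :
    scale u v (MvPolynomial.X 1) = MvPolynomial.C v * MvPolynomial.X 1 := by simp [scale]
@[simp] theorem scale_C (u v c : ℂ) : scale u v (MvPolynomial.C c) = MvPolynomial.C c := by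
  simp [scale, MvPolynomial.algebraMap_eq]

theorem euler_scale (u v : ℂ) (f : Poly) : euler (scale u v f) = scale u v (euler f) := by
  induction f using MvPolynomial.induction_on with
  | C c => simp
  | add f g hf hg => simp [hf, hg]
  | mul_X f i hf =>
    fin_cases i <;> simp [hf]

theorem scale_scale (u v u' v' : ℂ) (hu : u * u' = 1) (hv : v * v' = 1) (f : Poly) :
    scale u v (scale u' v' f) = f := by
  have e : ((scale u v).comp (scale u' v')) = AlgHom.id ℂ Poly := by
    refine MvPolynomial.algHom_ext fun i => ?_
    fin_cases i
    · have e := congrArg (MvPolynomial.C (σ := Fin 2)) hu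
      simp only [map_mul, map_one] at e
      simp
      linear_combination MvPolynomial.X 0 * e
    · have e := congrArg (MvPolynomial.C (σ := Fin 2)) hv
      simp only [map_mul, map_one] at e
      simp
      linear_combination MvPolynomial.X 1 * e
  exact congrArg (fun k => k f) e

variable [NeZero d]

/-- `η ^ a` for `a ∈ ℤ/d`, where `η = exp (2 π i / d)`. -/
abbrev etaPow (a : ZMod d) : ℂ := ZMod.stdAddChar a

theorem etaPow_eq (k : ℤ) :
    etaPow (k : ZMod d) = Complex.exp (2 * Real.pi * Complex.I / d) ^ k := by
  rw [etaPow, ZMod.stdAddChar_coe, ← Complex.exp_int_mul]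
  congr 1
  ring

/-- `∏ (x - η ^ j y)` over `j ∈ S`. -/
def permProd (S : Finset (ZMod d)) : Poly :=
  ∏ j ∈ S, (MvPolynomial.X 0 - MvPolynomial.C (etaPow j) * MvPolynomial.X 1)

theorem euler_permProd (S : Finset (ZMod d)) :
    euler (permProd S) = (S.card : ℂ) • permProd S := by
  classical
  induction S using Finset.induction_on with
  | empty => simp [permProd]
  | insert j S hj ih =>
    rw [permProd, Finset.prod_insert hj, Finset.card_insert_of_notMem hj, ← permProd]
    simp [ih, MvPolynomial.smul_eq_C_mul]
    ring

theorem permProd_univ :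
    permProd (Finset.univ : Finset (ZMod d)) = MvPolynomial.X 0 ^ d - MvPolynomial.X 1 ^ d := by
  classical
  have h : IsPrimitiveRoot (MvPolynomial.C (etaPow (1 : ZMod d)) : Poly) d := by
    refine IsPrimitiveRoot.map_of_injective ?_ (MvPolynomial.C_injective (Fin 2) ℂ)
    have := etaPow_eq (d := d) 1
    rw [Int.cast_one, zpow_one] at this
    rw [this]
    exact Complex.isPrimitiveRoot_exp d (NeZero.ne d)
  rw [h.pow_sub_pow_eq_prod_sub_mul _ _ (NeZero.pos d), permProd]
  have hinj : Function.Injective fun j : ZMod d => (MvPolynomial.C (etaPow j) : Poly) :=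
    (MvPolynomial.C_injective (Fin 2) ℂ).comp ZMod.injective_stdAddChar
  have himg : Polynomial.nthRootsFinset d (1 : Poly) =
      Finset.univ.image fun j : ZMod d => (MvPolynomial.C (etaPow j) : Poly) := by
    symm
    refine Finset.eq_of_subset_of_card_le ?_ ?_
    · intro t ht
      obtain ⟨j, -, rfl⟩ := Finset.mem_image.1 ht
      rw [Polynomial.mem_nthRootsFinset (NeZero.pos d), ← map_pow, etaPow,
        ← AddChar.map_nsmul_eq_pow]
      simp
    · rw [h.card_nthRootsFinset, Finset.card_image_of_injective _ hinj, Finset.card_univ,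
        ZMod.card]
  rw [himg, Finset.prod_image (fun i _ j _ h => hinj h)]

theorem permProd_mul_compl (S : Finset (ZMod d)) :
    permProd S * permProd Sᶜ = MvPolynomial.X 0 ^ d - MvPolynomial.X 1 ^ d := by
  rw [← permProd_univ, permProd, permProd, permProd, Finset.prod_mul_prod_compl]

/-- Multiplication by a polynomial on both summands. -/
def mulBoth (p : Poly) : Module.End ℂ (Poly × Poly) :=
  (LinearMap.mulLeft ℂ p).prodMap (LinearMap.mulLeft ℂ p)

theorem mulBoth_pow (p : Poly) (k : ℕ) : mulBoth p ^ k = mulBoth (p ^ k) := by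
  induction k with
  | zero => ext <;> simp [mulBoth]
  | succ k ih =>
    rw [pow_succ, ih]
    refine LinearMap.ext fun f => ?_
    simp [mulBoth, pow_succ]

/-- The permutation type bifactorisation `P_S`: even part `ℂ[x, y]`, odd part `ℂ[x, y]`. The
differential is multiplication by `∏_{j ∈ S} (x - η ^ j y)` from the odd to the even part, and by
`(x ^ d - y ^ d) / ∏_{j ∈ S} (x - η ^ j y) = ∏_{j ∉ S} (x - η ^ j y)` from the even to the odd part.

The even generator has charge `(1 - |S|) / d`. This fixes the charge `(|S| + 1) / d - 1` of the odd
generator. -/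
def permFact (S : Finset (ZMod d)) : Bifact d where
  carrier := Poly × Poly
  xl := mulBoth (MvPolynomial.X 0)
  xr := mulBoth (MvPolynomial.X 1)
  par := LinearMap.id.prodMap (-LinearMap.id)
  chg := ((2 / d : ℂ) • euler.toLinearMap + ((1 - S.card) / d : ℂ) • LinearMap.id).prodMap
    ((2 / d : ℂ) • euler.toLinearMap + ((S.card + 1) / d - 1 : ℂ) • LinearMap.id)
  diff := ((LinearMap.mulLeft ℂ (permProd S)) ∘ₗ LinearMap.snd ℂ Poly Poly).prod
    ((LinearMap.mulLeft ℂ (permProd Sᶜ)) ∘ₗ LinearMap.fst ℂ Poly Poly)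
  xl_xr := by rintro ⟨f, g⟩; ext1 <;> simp [mulBoth] <;> ring
  par_par := by rintro ⟨f, g⟩; ext1 <;> simp
  par_xl := by rintro ⟨f, g⟩; ext1 <;> simp [mulBoth]
  par_xr := by rintro ⟨f, g⟩; ext1 <;> simp [mulBoth]
  chg_xl := by
    rintro ⟨f, g⟩; ext1 <;> simp [mulBoth, MvPolynomial.smul_eq_C_mul] <;> ring
  chg_xr := by
    rintro ⟨f, g⟩; ext1 <;> simp [mulBoth, MvPolynomial.smul_eq_C_mul] <;> ring
  chg_par := by rintro ⟨f, g⟩; ext1 <;> simp <;> ring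
  chg_diagonalisable := by
    rw [eq_top_iff]
    rintro ⟨f, g⟩ -
    have hfg : ((f, g) : Poly × Poly) = (f, 0) + (0, g) := by simp
    rw [hfg]
    refine add_mem ?_ ?_
    · induction f using MvPolynomial.induction_on' with
      | add f f' hf hf' =>
        have e : ((f + f', 0) : Poly × Poly) = (f, 0) + (f', 0) := by simp
        rw [e]
        exact add_mem (hf (by simp)) (hf' (by simp))
      | monomial u c =>
        refine Submodule.mem_iSup_of_mem
          ((2 / d : ℂ) * ((u 0 + u 1 : ℕ) : ℂ) + ((1 - S.card) / d : ℂ)) ?_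
        rw [Module.End.mem_eigenspace_iff]
        ext1 <;> simp [euler_monomial, add_smul, mul_smul]
    · induction g using MvPolynomial.induction_on' with
      | add f f' hf hf' =>
        have e : ((0, f + f') : Poly × Poly) = (0, f) + (0, f') := by simp
        rw [e]
        exact add_mem (hf (by simp)) (hf' (by simp))
      | monomial u c =>
        refine Submodule.mem_iSup_of_mem
          ((2 / d : ℂ) * ((u 0 + u 1 : ℕ) : ℂ) + ((S.card + 1) / d - 1 : ℂ)) ?_
        rw [Module.End.mem_eigenspace_iff]
        ext1 <;> simp [euler_monomial, add_smul, mul_smul]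
  diff_xl := by rintro ⟨f, g⟩; ext1 <;> simp [mulBoth] <;> ring
  diff_xr := by rintro ⟨f, g⟩; ext1 <;> simp [mulBoth] <;> ring
  diff_par := by rintro ⟨f, g⟩; ext1 <;> simp
  chg_diff := by
    have hd : (d : ℂ) ≠ 0 := NeZero.ne _
    have hc : ((Sᶜ).card : ℂ) = d - S.card := by
      rw [Finset.card_compl, ZMod.card, Nat.cast_sub (by simpa using S.card_le_univ)]
    rintro ⟨f, g⟩
    ext1
    · have e : (2 / d : ℂ) * S.card + (1 - S.card) / d = ((S.card + 1) / d - 1 : ℂ) + 1 := by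
        field_simp; ring
      have e' := congrArg (fun c => c • (permProd S * g)) e
      simp only [add_smul, mul_smul, one_smul] at e'
      simp [euler_permProd, mul_add, smul_add, mul_comm g] at e' ⊢
      linear_combination (exp := 1) e'
    · have e : (2 / d : ℂ) * (d - S.card) + ((S.card + 1) / d - 1 : ℂ) = (1 - S.card) / d + 1 := by
        field_simp; ring
      have e' := congrArg (fun c => c • (permProd Sᶜ * f)) e
      simp only [add_smul, mul_smul, one_smul] at e'
      simp [euler_permProd, mul_add, smul_add, hc, mul_comm f] at e' ⊢
      linear_combination (exp := 1) e'
  diff_diff := by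
    rintro ⟨f, g⟩
    rw [mulBoth_pow, mulBoth_pow]
    ext1
    · simp [mulBoth]
      linear_combination f * permProd_mul_compl S
    · simp [mulBoth]
      linear_combination g * permProd_mul_compl S

/-- The element of `P_S` with even part `f` and odd part `g`. -/
def el (S : Finset (ZMod d)) (f g : Poly) : permFact S := ((f, g) : Poly × Poly)

/-- The even part of an element of `P_S`, as a polynomial. -/
def evenPart (S : Finset (ZMod d)) : permFact S →ₗ[ℂ] Poly := LinearMap.fst ℂ Poly Poly

/-- The linear map `(f, g) ↦ (A f, B g)` from `P_S` to `P_T`. -/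
def permMap (S T : Finset (ZMod d)) (A B : Poly →ₗ[ℂ] Poly) : permFact S →ₗ[ℂ] permFact T :=
  (A.prodMap B : Poly × Poly →ₗ[ℂ] Poly × Poly)

section el

variable (S T : Finset (ZMod d)) (f g : Poly)

theorem exists_el (t : permFact S) : ∃ f g, t = el S f g := ⟨t.1, t.2, rfl⟩
@[simp] theorem evenPart_el : evenPart S (el S f g) = f := rfl
@[simp] theorem permMap_el (A B : Poly →ₗ[ℂ] Poly) :
    permMap S T A B (el S f g) = el T (A f) (B g) := rfl
theorem add_el (f' g' : Poly) : el S f g + el S f' g' = el S (f + f') (g + g') := rfl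
theorem smul_el (c : ℂ) : c • el S f g = el S (c • f) (c • g) := rfl
@[simp] theorem xl_el : (permFact S).xl (el S f g) =
    el S (MvPolynomial.X 0 * f) (MvPolynomial.X 0 * g) := rfl
@[simp] theorem xr_el : (permFact S).xr (el S f g) =
    el S (MvPolynomial.X 1 * f) (MvPolynomial.X 1 * g) := rfl
@[simp] theorem par_el : (permFact S).par (el S f g) = el S f (-g) := rfl
@[simp] theorem chg_el : (permFact S).chg (el S f g) =
    el S ((2 / d : ℂ) • euler f + ((1 - S.card) / d : ℂ) • f)
      ((2 / d : ℂ) • euler g + ((S.card + 1) / d - 1 : ℂ) • g) := rfl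
@[simp] theorem diff_el : (permFact S).diff (el S f g) =
    el S (permProd S * g) (permProd Sᶜ * f) := rfl

end el

/-- `{m, …, m + l}` in `ℤ/d`. -/
def interval (m : ZMod d) (l : ℕ) : Finset (ZMod d) :=
  (Finset.range (l + 1)).image fun j : ℕ => m + (j : ZMod d)

/-- The translate `S + a`. -/
def shiftSet (S : Finset (ZMod d)) (a : ZMod d) : Finset (ZMod d) := S.image (· + a)

/-- `P_{m;l}`, the permutation type bifactorisation of `{m, …, m + l}`. -/
abbrev permInterval (m : ZMod d) (l : ℕ) : Bifact d := permFact (interval m l)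

/-- The invertible objects `P_{a;0}`. -/
abbrev line (a : ZMod d) : Bifact d := permFact {a}

/-- The tensor unit `P_{0;0}`. -/
abbrev unitObj (d : ℕ) [NeZero d] : Bifact d := permFact {0}

/-! ### The unitors -/

theorem actL_unit (M : Bifact d) (f : Poly) : actL M (permProd {(0 : ZMod d)} * f) = 0 := by
  simp [actL, permProd, diagonal]

theorem actR_unit (M : Bifact d) (f : Poly) : actR M (permProd {(0 : ZMod d)} * f) = 0 := by
  simp [actR, permProd, diagonal]

/-- The left unitor `f (x, y) ⊗ m ↦ f (x, x) m`, zero on the odd part of the unit. -/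
def leftUnitor (M : Bifact d) : unitObj d ⊙ M ⟶ M :=
  homClass ⟨tensorLift (actL M ∘ₗ evenPart {0}) (by
      intro t m
      obtain ⟨f, g, rfl⟩ := exists_el _ t
      simp [mul_comm _ f]), by
    refine ⟨?_, ?_, ?_, ?_, ?_⟩ <;> intro t <;> induction t using tensor_induction with
      | add s t hs ht => simp only [map_add, hs, ht]
      | tmul t m =>
        obtain ⟨f, g, rfl⟩ := exists_el _ t
        first
        | simp [mul_comm _ f, actL_comm M.xl (fun _ => rfl)]; done
        | simp [actL_comm M.xr (fun m => (M.xl_xr m).symm)]; done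
        | simp [actL_comm M.par M.par_xl]; done
        | simp [chg_actL]; abel; done
        | simp [actL_comm M.diff M.diff_xl, actL_unit]; done⟩

/-- The right unitor `m ⊗ f (x, y) ↦ m f (y, y)`, zero on the odd part of the unit. -/
def rightUnitor (M : Bifact d) : M ⊙ unitObj d ⟶ M :=
  homClass ⟨tensorLift (actR M ∘ₗ evenPart {0}).flip (by
      intro m t
      obtain ⟨f, g, rfl⟩ := exists_el _ t
      simp [mul_comm _ f]), by
    refine ⟨?_, ?_, ?_, ?_, ?_⟩ <;> intro t <;> induction t using tensor_induction with
      | add s t hs ht => simp only [map_add, hs, ht]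
      | tmul m t =>
        obtain ⟨f, g, rfl⟩ := exists_el _ t
        first
        | simp [actR_comm M.xl M.xl_xr]; done
        | simp [mul_comm _ f, actR_comm M.xr (fun _ => rfl)]; done
        | simp [actR_comm M.par M.par_xr]; done
        | simp [chg_actR]; done
        | simp [actR_comm M.diff M.diff_xr, actR_unit]; done⟩

/-! ### Twisting -/

theorem etaPow_pow (a : ZMod d) : etaPow a ^ d = 1 := by
  rw [etaPow, ← AddChar.map_nsmul_eq_pow]
  simp

/-- The twist `_a M_b`: `x` acts on the left as `η ^ (-a) x` and on the right as `η ^ b x`. -/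
def twist (a b : ZMod d) (M : Bifact d) : Bifact d where
  carrier := M
  xl := etaPow (-a) • M.xl
  xr := etaPow b • M.xr
  par := M.par
  chg := M.chg
  diff := M.diff
  xl_xr m := by simp [M.xl_xr, smul_comm (etaPow b)]
  par_par := M.par_par
  par_xl m := by simp [M.par_xl]
  par_xr m := by simp [M.par_xr]
  chg_xl m := by simp [M.chg_xl, smul_comm (etaPow (-a))]
  chg_xr m := by simp [M.chg_xr, smul_comm (etaPow b)]
  chg_par := M.chg_par
  chg_diagonalisable := M.chg_diagonalisable
  diff_xl m := by simp [M.diff_xl]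
  diff_xr m := by simp [M.diff_xr]
  diff_par := M.diff_par
  chg_diff := M.chg_diff
  diff_diff m := by rw [smul_pow, smul_pow, etaPow_pow, etaPow_pow, one_smul, one_smul, M.diff_diff]

/-- The identity map onto the twist. -/
def toTwist (a b : ZMod d) (M : Bifact d) : M →ₗ[ℂ] twist a b M := LinearMap.id (M := M)

/-- The identity map from the twist. -/
def ofTwist (a b : ZMod d) (M : Bifact d) : twist a b M →ₗ[ℂ] M := LinearMap.id (M := M)

section toTwist

variable (a b : ZMod d) (M : Bifact d) (m : M)

@[simp] theorem ofTwist_toTwist : ofTwist a b M (toTwist a b M m) = m := rfl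
@[simp] theorem toTwist_ofTwist (t : twist a b M) : toTwist a b M (ofTwist a b M t) = t := rfl
theorem exists_toTwist (t : twist a b M) : ∃ m, t = toTwist a b M m := ⟨t, rfl⟩
@[simp] theorem xl_toTwist :
    (twist a b M).xl (toTwist a b M m) = etaPow (-a) • toTwist a b M (M.xl m) := rfl
@[simp] theorem xr_toTwist :
    (twist a b M).xr (toTwist a b M m) = etaPow b • toTwist a b M (M.xr m) := rfl
@[simp] theorem par_toTwist : (twist a b M).par (toTwist a b M m) = toTwist a b M (M.par m) := rfl
@[simp] theorem chg_toTwist : (twist a b M).chg (toTwist a b M m) = toTwist a b M (M.chg m) := rfl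
@[simp] theorem diff_toTwist :
    (twist a b M).diff (toTwist a b M m) = toTwist a b M (M.diff m) := rfl

end toTwist

/-- The identification `M_a ⊗ N = M ⊗ _a N`, which is the identity on pure tensors. -/
def twistMiddle (a : ZMod d) (M N : Bifact d) : twist 0 a M ⊙ N ≅ M ⊙ twist a 0 N :=
  isoMk
    ⟨tensorLift ((tmulL M (twist a 0 N)).compl₁₂ (ofTwist 0 a M) (toTwist a 0 N)) (by
      intro t n
      obtain ⟨m, hm⟩ := exists_toTwist _ _ _ t
      rw [hm]
      simp [xr_tmul, smul_smul, ← AddChar.map_add_eq_mul]), by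
      refine ⟨?_, ?_, ?_, ?_, ?_⟩ <;> intro t <;> induction t using tensor_induction with
        | add s t hs ht => simp only [map_add, hs, ht]
        | tmul t n =>
          obtain ⟨m, hm⟩ := exists_toTwist _ _ _ t
          rw [hm]
          simp⟩
    (tensorLift ((tmulL (twist 0 a M) N).compl₁₂ (toTwist 0 a M) (ofTwist a 0 N)) (by
      intro m t
      obtain ⟨n, hn⟩ := exists_toTwist _ _ _ t
      rw [hn]
      have h := xr_tmul (toTwist 0 a M m) n
      simp only [xr_toTwist, smul_tmul] at h
      simp [← h, smul_smul, ← AddChar.map_add_eq_mul]))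
    (fun t => by
      induction t using tensor_induction with
      | add s t hs ht => simp only [map_add, hs, ht]
      | tmul m n => simp)
    (fun t => by
      induction t using tensor_induction with
      | add s t hs ht => simp only [map_add, hs, ht]
      | tmul m n => simp)

theorem card_shiftSet (S : Finset (ZMod d)) (a : ZMod d) : (shiftSet S a).card = S.card :=
  Finset.card_image_of_injective _ (add_left_injective a)

theorem shiftSet_compl (S : Finset (ZMod d)) (a : ZMod d) :
    (shiftSet S a)ᶜ = shiftSet Sᶜ a :=
  by
  ext j
  simp [shiftSet, ← eq_sub_iff_add_eq]

theorem scale_permProd (a b : ZMod d) (S : Finset (ZMod d)) :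
    scale (etaPow (-a)) (etaPow b) (permProd (shiftSet S (-a - b))) =
      etaPow (-((S.card : ZMod d) * a)) • permProd S := by
  have e0 : etaPow (-((S.card : ZMod d) * a)) = etaPow (-a) ^ S.card := by
    rw [← AddChar.map_nsmul_eq_pow]
    simp
  rw [permProd, shiftSet, Finset.prod_image (fun i _ j _ h => add_left_injective _ h), map_prod,
    e0, permProd, ← Finset.prod_const, MvPolynomial.smul_eq_C_mul, map_prod, ← Finset.prod_mul_distrib]
  refine Finset.prod_congr rfl fun j _ => ?_
  have e : etaPow (j + (-a - b)) * etaPow b = etaPow (-a) * etaPow j := by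
    rw [← AddChar.map_add_eq_mul, ← AddChar.map_add_eq_mul]
    congr 1
    ring
  have e' := congrArg (MvPolynomial.C (σ := Fin 2)) e
  simp only [map_mul] at e'
  simp only [map_sub, map_mul, scale_X_zero, scale_X_one, scale_C]
  linear_combination (-MvPolynomial.X 1) * e'

theorem scale_permProd_compl (a b : ZMod d) (S : Finset (ZMod d)) :
    scale (etaPow (-a)) (etaPow b) (permProd (shiftSet S (-a - b))ᶜ) =
      etaPow ((S.card : ZMod d) * a) • permProd Sᶜ := by
  rw [shiftSet_compl, scale_permProd, Finset.card_compl, ZMod.card,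
    Nat.cast_sub (by simpa using S.card_le_univ)]
  simp

/-- The untwisting isomorphism `s_{a,b} : P_{S-a-b} → _a (P_S)_b`. -/
def untwist (a b : ZMod d) {S T : Finset (ZMod d)} (h : T = shiftSet S (-a - b)) :
    permFact T ≅ twist a b (permFact S) :=
  isoMk
    ⟨toTwist a b (permFact S) ∘ₗ permMap T S (scale (etaPow (-a)) (etaPow b)).toLinearMap
      (etaPow (-((S.card : ZMod d) * a)) • (scale (etaPow (-a)) (etaPow b)).toLinearMap), by
      subst h
      refine ⟨?_, ?_, ?_, ?_, ?_⟩ <;> intro t <;> obtain ⟨f, g, rfl⟩ := exists_el _ t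
      · simp [← map_smul, smul_el, MvPolynomial.smul_eq_C_mul, mul_assoc, mul_left_comm]
      · simp [← map_smul, smul_el, MvPolynomial.smul_eq_C_mul, mul_assoc, mul_left_comm]
      · simp
      · simp [euler_scale, card_shiftSet, smul_comm (etaPow (-((S.card : ZMod d) * a)))]
      · simp [scale_permProd, scale_permProd_compl, smul_smul, ← AddChar.map_add_eq_mul]⟩
    (permMap S T (scale (etaPow a) (etaPow (-b))).toLinearMap
      (etaPow ((S.card : ZMod d) * a) • (scale (etaPow a) (etaPow (-b))).toLinearMap) ∘ₗ
      ofTwist a b (permFact S))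
    (fun t => by
      obtain ⟨f, g, rfl⟩ := exists_el _ t
      simp [scale_scale, smul_smul, ← AddChar.map_add_eq_mul])
    (fun t => by
      obtain ⟨t, ht⟩ := exists_toTwist _ _ _ t
      rw [ht]
      obtain ⟨f, g, rfl⟩ := exists_el _ t
      simp [scale_scale, smul_smul, ← AddChar.map_add_eq_mul])

/-! ### Fusion with the invertible objects -/

/-- `ψ^L_{a;S} : a P_S → P_{S+a}`. -/
def psiL (a : ZMod d) {S T : Finset (ZMod d)} (h : T = shiftSet S a) :
    line a ⊙ permFact S ⟶ permFact T :=
  ((untwist 0 (-a) (S := {0}) (T := {a}) (by simp [shiftSet])).hom ⊙ₘ 𝟙 (permFact S)) ≫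
    (twistMiddle (-a) (unitObj d) (permFact S)).hom ≫
    (𝟙 (unitObj d) ⊙ₘ (untwist (-a) 0 (S := S) (T := T) (by simpa using h)).inv) ≫
    leftUnitor (permFact T)

/-- `ψ^R_{S;a} : P_S a → P_{S+a}`. -/
def psiR (a : ZMod d) {S T : Finset (ZMod d)} (h : T = shiftSet S a) :
    permFact S ⊙ line a ⟶ permFact T :=
  (𝟙 (permFact S) ⊙ₘ (untwist (-a) 0 (S := {0}) (T := {a}) (by simp [shiftSet])).hom) ≫
    (twistMiddle (-a) (permFact S) (unitObj d)).inv ≫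
    ((untwist 0 (-a) (S := S) (T := T) (by simpa using h)).inv ⊙ₘ 𝟙 (unitObj d)) ≫
    rightUnitor (permFact T)

/-- The evaluation `ev_a : (-a) a → 1`. -/
def ev (a : ZMod d) : line (-a) ⊙ line a ⟶ unitObj d := 
  psiL (-a) (S := {a}) (T := {0}) (by simp [shiftSet])

theorem shiftSet_neg (S : Finset (ZMod d)) (a : ZMod d) :
    S = shiftSet (shiftSet S a) (-a) := by
  ext j
  simp [shiftSet]

theorem shiftSet_neg' (S : Finset (ZMod d)) (a : ZMod d) :
    S = shiftSet (shiftSet S (-a)) a := by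
  ext j
  simp [shiftSet]

/-! ### The two sides of the identity

The morphisms below use the inverses of `ψ^L` and `ψ^R` in the homotopy category. -/

section conj

variable [∀ (a : ZMod d) (S T : Finset (ZMod d)) (h : T = shiftSet S a), IsIso (psiL a h)]
  [∀ (a : ZMod d) (S T : Finset (ZMod d)) (h : T = shiftSet S a), IsIso (psiR a h)]

/-- `P_S → P_{S+a} (-a) → (a P_S) (-a)`, by the inverses of `ψ^R_{S+a;-a}` and `ψ^L_{a;S}`. -/
def conjL (a : ZMod d) (S : Finset (ZMod d)) :
    permFact S ⟶ (line a ⊙ permFact S) ⊙ line (-a) :=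
  inv (psiR (-a) (S := shiftSet S a) (T := S) (shiftSet_neg S a)) ≫
    (inv (psiL a (S := S) (T := shiftSet S a) rfl) ⊙ₘ 𝟙 (line (-a)))

/-- `P_S → a P_{S-a} → a (P_S (-a))`, by the inverses of `ψ^L_{a;S-a}` and `ψ^R_{S;-a}`. -/
def conjR (a : ZMod d) (S : Finset (ZMod d)) :
    permFact S ⟶ line a ⊙ (permFact S ⊙ line (-a)) :=
  inv (psiL a (S := shiftSet S (-a)) (T := S) (shiftSet_neg' S a)) ≫
    (𝟙 (line a) ⊙ₘ inv (psiR (-a) (S := S) (T := shiftSet S (-a)) rfl))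

/-- The evaluation cap: `((a M) (-a)) (a (N (-a))) → (a (M N)) (-a)`, which is `1 ⊗ ev_a ⊗ 1`
applied to the two middle factors, up to associators and a unitor. -/
def cap (a : ZMod d) (M N : Bifact d) :
    ((line a ⊙ M) ⊙ line (-a)) ⊙ (line a ⊙ (N ⊙ line (-a))) ⟶
      (line a ⊙ (M ⊙ N)) ⊙ line (-a) :=
  (associator (line a ⊙ M) (line (-a)) (line a ⊙ (N ⊙ line (-a)))).hom ≫
    (𝟙 (line a ⊙ M) ⊙ₘ
      ((associator (line (-a)) (line a) (N ⊙ line (-a))).inv ≫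
        (ev a ⊙ₘ 𝟙 (N ⊙ line (-a))) ≫ leftUnitor (N ⊙ line (-a)))) ≫
    (associator (line a ⊙ M) N (line (-a))).inv ≫
    ((associator (line a) M N).hom ⊙ₘ 𝟙 (line (-a)))

/-- The left-hand diagram: `P_S → (a P_S) (-a) → (a (P_{S'} P_{S''})) (-a)`, that is, `1 ⊗ φ ⊗ 1`
after the fusion of `a` and `-a` into the strand below the vertex. -/
def conjOutside (a : ZMod d) {S S' S'' : Finset (ZMod d)}
    (φ : permFact S ⟶ permFact S' ⊙ permFact S'') :
    permFact S ⟶ (line a ⊙ (permFact S' ⊙ permFact S'')) ⊙ line (-a) :=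
  conjL a S ≫ ((𝟙 (line a) ⊙ₘ φ) ⊙ₘ 𝟙 (line (-a)))

/-- The right-hand diagram: the vertex `φ`, followed by the fusion of `a` and `-a` into each of
the two legs, the inner `-a` and `a` being joined by the evaluation cap. -/
def conjLegs (a : ZMod d) {S S' S'' : Finset (ZMod d)}
    (φ : permFact S ⟶ permFact S' ⊙ permFact S'') :
    permFact S ⟶ (line a ⊙ (permFact S' ⊙ permFact S'')) ⊙ line (-a) :=
  φ ≫ (conjL a S' ⊙ₘ conjR a S'') ≫ cap a (permFact S') (permFact S'')

end conj

end perm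

end

end LandauGinzburg

open CategoryTheory LandauGinzburg

/-
Sandwiching a bimodule `M` between the lines `a` and `-a` amounts to twisting it: composing with
`sandwich a : (a M) (-a) → _{-a} M_a`, which is natural in `M`, turns both `κ^L` and `κ^R` into the
isomorphism `s_{-a,a}` of `P_S` with its own twist. The two sides of the claim thereby become
`s_{-a,a}` followed by the twist of `φ`, and `φ` followed by `s_{-a,a} ⊗ s_{-a,a}`. Now `s_{-a,a}`
rescales a monomial of degree `k` by `η^{a k}`, and the charge of the monomial is `2 k / d` up to a
shift depending on `|S|` and its parity, so `s_{-a,a}` acts on the part of charge `q` as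
`e^{π i a q}` times the `a`-th power of the parity operator times a constant depending on `|S|`.
As `φ` preserves charge and parity, the two sides differ by the quotient of these constants.

That the `ψ` are isomorphisms comes down to the unitors, whose kernels are contracted explicitly.
-/

namespace LandauGinzburg

noncomputable section

section Basics

variable {d : ℕ} {M M' M'' N N' N'' P : Bifact d}

/-- The homotopy class of a chain map, as a morphism. -/
def homMk (f : cycles M N) : M ⟶ N := homClass f

/-- The identity chain map. -/
def cyclesId (M : Bifact d) : cycles M M :=
  ⟨LinearMap.id, by refine ⟨?_, ?_, ?_, ?_, ?_⟩ <;> simp⟩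

@[simp] theorem cyclesId_apply (m : M) : (cyclesId M).1 m = m := rfl

@[simp] theorem cyclesComp_apply (f : cycles M N) (g : cycles N P) (m : M) :
    (cyclesComp f g).1 m = g.1 (f.1 m) := rfl

@[simp] theorem cyclesTensor_tmul (f : cycles M M') (g : cycles N N') (m : M) (n : N) :
    (cyclesTensor f g).1 (m ⊗ₚ n) = f.1 m ⊗ₚ g.1 n :=
  tensorMap_tmul f.1 g.1 f.2.2.1 g.2.1 m n

theorem zero_tmul (n : N) : (0 : M) ⊗ₚ n = 0 := map_zero ((tmulL M N).flip n)

theorem tmul_zero (m : M) : m ⊗ₚ (0 : N) = 0 := map_zero (tmulL M N m)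

theorem exists_homMk (φ : M ⟶ N) : ∃ f, φ = homMk f := by
  obtain ⟨f⟩ := φ
  exact ⟨f, rfl⟩

theorem homMk_id (M : Bifact d) : 𝟙 M = homMk (cyclesId M) := rfl

theorem homMk_comp (f : cycles M N) (g : cycles N P) :
    homMk f ≫ homMk g = homMk (cyclesComp f g) := rfl

theorem homMk_tensor (f : cycles M M') (g : cycles N N') :
    homMk f ⊙ₘ homMk g = homMk (cyclesTensor f g) := rfl

theorem homMk_smul (c : ℂ) (f : cycles M N) : c • homMk f = homMk (c • f) := rfl

theorem homMk_congr {f g : cycles M N} (h : ∀ m, f.1 m = g.1 m) : homMk f = homMk g :=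
  congrArg homClass (Subtype.ext (LinearMap.ext h))

theorem homMk_congr_tmul {f g : cycles (M ⊙ N) P}
    (h : ∀ m n, f.1 (m ⊗ₚ n) = g.1 (m ⊗ₚ n)) : homMk f = homMk g :=
  homMk_congr fun t => by
    induction t using tensor_induction with
    | tmul m n => exact h m n
    | add s t hs ht => rw [map_add, map_add, hs, ht]

theorem tensorHom_comp (f : M ⟶ M') (f' : M' ⟶ M'') (g : N ⟶ N') (g' : N' ⟶ N'') :
    (f ⊙ₘ g) ≫ (f' ⊙ₘ g') = (f ≫ f') ⊙ₘ (g ≫ g') := by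
  obtain ⟨f, rfl⟩ := exists_homMk f
  obtain ⟨f', rfl⟩ := exists_homMk f'
  obtain ⟨g, rfl⟩ := exists_homMk g
  obtain ⟨g', rfl⟩ := exists_homMk g'
  exact homMk_congr_tmul fun m n => by simp

theorem tensorHom_id (M N : Bifact d) : 𝟙 M ⊙ₘ 𝟙 N = 𝟙 (M ⊙ N) :=
  homMk_congr_tmul fun m n => cyclesTensor_tmul (cyclesId M) (cyclesId N) m n

instance (f : M ⟶ M') (g : N ⟶ N') [IsIso f] [IsIso g] : IsIso (f ⊙ₘ g) :=
  ⟨inv f ⊙ₘ inv g, by simp [tensorHom_comp, tensorHom_id], by simp [tensorHom_comp, tensorHom_id]⟩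

theorem smul_comp_eq (c : ℂ) (f : M ⟶ N) (g : N ⟶ P) : (c • f) ≫ g = c • (f ≫ g) := by
  obtain ⟨f, rfl⟩ := exists_homMk f
  obtain ⟨g, rfl⟩ := exists_homMk g
  exact homMk_congr fun m => map_smul g.1 c (f.1 m)

end Basics

section Contraction

variable {d : ℕ} {C M N : Bifact d}

/-- The even bilinear maps of charge `0` between the underlying bigraded bimodules; nothing is
asked about the differentials. -/
structure IsGraded (f : M →ₗ[ℂ] N) : Prop where
  map_xl : ∀ m, f (M.xl m) = N.xl (f m)
  map_xr : ∀ m, f (M.xr m) = N.xr (f m)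
  map_par : ∀ m, f (M.par m) = N.par (f m)
  map_chg : ∀ m, f (M.chg m) = N.chg (f m)

/-- The odd bilinear maps of charge `-1`, which are the homotopies of `boundaries`. -/
structure IsHomotopy (h : M →ₗ[ℂ] N) : Prop where
  map_xl : ∀ m, h (M.xl m) = N.xl (h m)
  map_xr : ∀ m, h (M.xr m) = N.xr (h m)
  map_par : ∀ m, h (M.par m) = -N.par (h m)
  chg_map : ∀ m, N.chg (h m) = h (M.chg m) - h m

theorem isGraded_of_cycles (f : cycles M N) : IsGraded f.1 :=
  ⟨f.2.1, f.2.2.1, f.2.2.2.1, f.2.2.2.2.1⟩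

theorem IsHomotopy.comp {f : M →ₗ[ℂ] N} {h : N →ₗ[ℂ] C} (hh : IsHomotopy h) (hf : IsGraded f) :
    IsHomotopy (h ∘ₗ f) where
  map_xl m := by simp [hf.map_xl, hh.map_xl]
  map_xr m := by simp [hf.map_xr, hh.map_xr]
  map_par m := by simp [hf.map_par, hh.map_par]
  chg_map m := by simp [hf.map_chg, hh.chg_map]

theorem IsGraded.id_sub_comp {f : M →ₗ[ℂ] N} {g : N →ₗ[ℂ] M} (hf : IsGraded f) (hg : IsGraded g) :
    IsGraded (LinearMap.id - g ∘ₗ f : M →ₗ[ℂ] M) where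
  map_xl m := by simp [hf.map_xl, hg.map_xl]
  map_xr m := by simp [hf.map_xr, hg.map_xr]
  map_par m := by simp [hf.map_par, hg.map_par]
  map_chg m := by simp [hf.map_chg, hg.map_chg]

theorem IsGraded.map_diff_diff {f : M →ₗ[ℂ] N} (hf : IsGraded f) (m : M) :
    f (M.diff (M.diff m)) = N.diff (N.diff (f m)) := by
  have map_pow {X : Module.End ℂ M} {Y : Module.End ℂ N} (h : ∀ m, f (X m) = Y (f m)) :
      f ((X ^ d) m) = (Y ^ d) (f m) := by
    simpa only [Module.End.coe_pow] using Function.Semiconj.iterate_right (f := f) h d m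
  rw [M.diff_diff, N.diff_diff, map_sub, map_pow hf.map_xl, map_pow hf.map_xr]

theorem homMk_eq_of_homotopy {f g : cycles M N} {h : M →ₗ[ℂ] N} (hh : IsHomotopy h)
    (hfg : ∀ m, f.1 m - g.1 m = N.diff (h m) + h (M.diff m)) : homMk f = homMk g :=
  homClass_eq.2 ⟨h, hh.map_xl, hh.map_xr, hh.map_par, hh.chg_map, hfg⟩

/-- The failure `D s - s D` of a graded map `s` to be a chain map. -/
def chainDefect (s : M →ₗ[ℂ] C) : M →ₗ[ℂ] C := C.diff ∘ₗ s - s ∘ₗ M.diff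

theorem chainDefect_apply (s : M →ₗ[ℂ] C) (m : M) :
    chainDefect s m = C.diff (s m) - s (M.diff m) := rfl

theorem IsGraded.diff_chainDefect {s : M →ₗ[ℂ] C} (hs : IsGraded s) (m : M) :
    C.diff (chainDefect s m) = -chainDefect s (M.diff m) := by
  simp only [chainDefect_apply, map_sub, hs.map_diff_diff]
  abel

theorem IsGraded.chg_chainDefect {s : M →ₗ[ℂ] C} (hs : IsGraded s) (m : M) :
    C.chg (chainDefect s m) = chainDefect s (M.chg m) + chainDefect s m := by
  simp only [chainDefect_apply, map_sub, map_add, C.chg_diff, ← hs.map_chg, M.chg_diff]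
  abel

theorem map_chainDefect (p : cycles C M) {s : M →ₗ[ℂ] C} (ps : ∀ m, p.1 (s m) = m) (m : M) :
    p.1 (chainDefect s m) = 0 := by
  rw [chainDefect_apply, map_sub, p.2.2.2.2.2, ps, ps, sub_self]

/-- A graded section `s` of a chain map is corrected to a chain map by a contraction of the
kernel. -/
theorem IsGraded.sub_comp_chainDefect_mem_cycles {s : M →ₗ[ℂ] C} {h : C →ₗ[ℂ] C} (hs : IsGraded s)
    (hh : IsHomotopy h)
    (contr : ∀ m, C.diff (h (chainDefect s m)) + h (C.diff (chainDefect s m)) = chainDefect s m) :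
    s - h ∘ₗ chainDefect s ∈ cycles M C := by
  refine ⟨fun m => ?_, fun m => ?_, fun m => ?_, fun m => ?_, fun m => ?_⟩ <;>
    simp only [LinearMap.sub_apply, LinearMap.comp_apply, map_sub]
  · simp only [chainDefect_apply, hs.map_xl, M.diff_xl, C.diff_xl, ← map_sub, hh.map_xl]
  · simp only [chainDefect_apply, hs.map_xr, M.diff_xr, C.diff_xr, ← map_sub, hh.map_xr]
  · have defect_par : chainDefect s (M.par m) = -C.par (chainDefect s m) := by
      simp only [chainDefect_apply, hs.map_par, M.diff_par, C.diff_par, map_sub, map_neg]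
      abel
    rw [defect_par, map_neg, hh.map_par, hs.map_par, neg_neg]
  · rw [hh.chg_map, hs.chg_chainDefect, map_add, hs.map_chg, add_sub_cancel_right]
  · have e := contr m
    rw [hs.diff_chainDefect, map_neg, ← sub_eq_add_neg, sub_eq_iff_eq_add] at e
    rw [e, chainDefect_apply s m]
    abel

theorem isIso_homMk_of_contraction (p : cycles C M) {s : M →ₗ[ℂ] C} {h : C →ₗ[ℂ] C}
    (hs : IsGraded s) (ps : ∀ m, p.1 (s m) = m) (hh : IsHomotopy h) (ph : ∀ c, p.1 (h c) = 0)
    (contr : ∀ c, p.1 c = 0 → C.diff (h c) + h (C.diff c) = c) : IsIso (homMk p) := by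
  let t : cycles M C := ⟨s - h ∘ₗ chainDefect s,
    hs.sub_comp_chainDefect_mem_cycles hh fun m => contr _ (map_chainDefect p ps m)⟩
  have pt (m : M) : p.1 (t.1 m) = m := by
    rw [show t.1 m = s m - h (chainDefect s m) from rfl, map_sub, ps, ph, sub_zero]
  refine ⟨homMk t, ?_, homMk_congr pt⟩
  have graded := (isGraded_of_cycles p).id_sub_comp (isGraded_of_cycles t)
  refine (homMk_eq_of_homotopy (f := cyclesId C) (hh.comp graded) fun c => ?_).symm
  have mem_ker : p.1 (c - t.1 (p.1 c)) = 0 := by rw [map_sub, pt, sub_self]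
  have e := contr _ mem_ker
  rw [map_sub C.diff, ← t.2.2.2.2.2, ← p.2.2.2.2.2] at e
  exact e.symm

/-- A decomposition of the kernel of a chain map `p` into the range of a projection `Q` and a
complement which `(1 - Q) D` maps isomorphically onto each other; `K` is the inverse of
`(1 - Q) D`. -/
structure KernelSplitting (p : cycles C M) where
  Q : C →ₗ[ℂ] C
  K : C →ₗ[ℂ] C
  isGraded : IsGraded Q
  p_Q : ∀ c, p.1 (Q c) = 0
  Q_K : ∀ c, Q (K c) = K c
  K_Q : ∀ c, K (Q c) = 0
  K_diff_Q : ∀ c, K (C.diff (Q c)) = Q c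
  diff_K : ∀ c, p.1 c = 0 → C.diff (K c) - Q (C.diff (K c)) = c - Q c

namespace KernelSplitting

variable {p : cycles C M} (σ : KernelSplitting p)

theorem p_K (c : C) : p.1 (σ.K c) = 0 := by rw [← σ.Q_K, σ.p_Q]

theorem K_eq {c w : C} (hw : σ.Q w = w) (h : C.diff w - σ.Q (C.diff w) = c - σ.Q c) :
    σ.K c = w :=
  calc σ.K c = σ.K (c - σ.Q c) := by rw [map_sub, σ.K_Q, sub_zero]
    _ = σ.K (C.diff w) := by rw [← h, map_sub, σ.K_Q, sub_zero]
    _ = w := by rw [← hw, σ.K_diff_Q]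

theorem diff_K_add_K_diff {c : C} (hc : p.1 c = 0) : C.diff (σ.K c) + σ.K (C.diff c) = c := by
  have Q_sub : σ.Q (c - C.diff (σ.K c)) = c - C.diff (σ.K c) := by
    rw [map_sub, sub_eq_sub_iff_sub_eq_sub, ← neg_inj, neg_sub, neg_sub, σ.diff_K c hc]
  have diff_diff : σ.Q (C.diff (C.diff (σ.K c))) = C.diff (C.diff (σ.K c)) := by
    rw [σ.isGraded.map_diff_diff, σ.Q_K]
  have K_diff : σ.K (C.diff c) = c - C.diff (σ.K c) :=
    σ.K_eq Q_sub (by rw [map_sub, map_sub, diff_diff]; abel)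
  rw [K_diff, add_sub_cancel]

/-- The inverse `K` of `(1 - Q) D` inherits linearity and degree from `D`, but only on the
kernel. -/
theorem isHomotopy_K_comp {f : N →ₗ[ℂ] C} (hf : IsGraded f) (pf : ∀ c, p.1 (f c) = 0) :
    IsHomotopy (σ.K ∘ₗ f) where
  map_xl c := by
    rw [LinearMap.comp_apply, hf.map_xl]
    refine σ.K_eq (by simp [σ.isGraded.map_xl, σ.Q_K]) ?_
    simp [C.diff_xl, σ.isGraded.map_xl, ← map_sub, σ.diff_K _ (pf c)]
  map_xr c := by
    rw [LinearMap.comp_apply, hf.map_xr]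
    refine σ.K_eq (by simp [σ.isGraded.map_xr, σ.Q_K]) ?_
    simp [C.diff_xr, σ.isGraded.map_xr, ← map_sub, σ.diff_K _ (pf c)]
  map_par c := by
    rw [LinearMap.comp_apply, hf.map_par]
    refine σ.K_eq (by simp [σ.isGraded.map_par, σ.Q_K]) ?_
    simp [C.diff_par, σ.isGraded.map_par, ← map_sub, σ.diff_K _ (pf c)]
  chg_map c := by
    rw [LinearMap.comp_apply, LinearMap.comp_apply, hf.map_chg, eq_sub_iff_add_eq, eq_comm]
    refine σ.K_eq (by simp [σ.isGraded.map_chg, σ.Q_K]) ?_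
    rw [map_add C.diff, ← C.chg_diff, σ.isGraded.map_chg, σ.isGraded.map_chg, ← map_sub,
      σ.diff_K _ (pf c), map_sub]

theorem isIso_homMk (σ : KernelSplitting p) {s : M →ₗ[ℂ] C} (hs : IsGraded s)
    (ps : ∀ m, p.1 (s m) = m) : IsIso (homMk p) := by
  have graded := (isGraded_of_cycles p).id_sub_comp hs
  refine isIso_homMk_of_contraction p hs ps
    (σ.isHomotopy_K_comp graded fun c => by simp [ps]) (fun c => σ.p_K _) fun c hc => ?_
  have hDc : p.1 (C.diff c) = 0 := by rw [p.2.2.2.2.2, hc, map_zero]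
  simpa [hc, hDc] using σ.diff_K_add_K_diff hc

end KernelSplitting

end Contraction

section Unitors

open MvPolynomial

variable {d : ℕ} {M N : Bifact d}

/-- The action of `f (x, y)` on a bimodule, with `x` acting from the left and `y` from the
right. -/
def biact (M : Bifact d) : Poly →ₗ[ℂ] Module.End ℂ M :=
  (basisMonomials (Fin 2) ℂ).constr ℂ fun u => M.xl ^ u 0 * M.xr ^ u 1

theorem biact_monomial (u : Fin 2 →₀ ℕ) (c : ℂ) :
    biact M (monomial u c) = c • (M.xl ^ u 0 * M.xr ^ u 1) := by
  have e : biact M (monomial u 1) = M.xl ^ u 0 * M.xr ^ u 1 := by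
    simpa only [biact, coe_basisMonomials] using
      (basisMonomials (Fin 2) ℂ).constr_basis ℂ (fun u => M.xl ^ u 0 * M.xr ^ u 1) u
  rw [← e, ← map_smul, smul_monomial, smul_eq_mul, mul_one]

@[simp] theorem biact_C (c : ℂ) (m : M) : biact M (C c) m = c • m := by
  rw [C_apply, biact_monomial]
  simp

@[simp] theorem biact_mul_X_zero (f : Poly) (m : M) : biact M (f * X 0) m = M.xl (biact M f m) := by
  induction f using MvPolynomial.induction_on' with
  | monomial u c => simp [X, monomial_mul, biact_monomial, pow_succ']
  | add f g hf hg => simp only [add_mul, map_add, LinearMap.add_apply, hf, hg]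

@[simp] theorem biact_mul_X_one (f : Poly) (m : M) : biact M (f * X 1) m = M.xr (biact M f m) := by
  have commute : Commute M.xl M.xr := LinearMap.ext M.xl_xr
  induction f using MvPolynomial.induction_on' with
  | monomial u c =>
    have e : M.xl ^ u 0 * M.xr ^ (u 1 + 1) = M.xr * (M.xl ^ u 0 * M.xr ^ u 1) := by
      rw [pow_succ', ← mul_assoc, ← mul_assoc, (commute.pow_left _).eq]
    simpa [X, monomial_mul, biact_monomial] using congrArg (fun A => c • A m) e
  | add f g hf hg => simp only [add_mul, map_add, LinearMap.add_apply, hf, hg]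

theorem biact_comm (A : M →ₗ[ℂ] N) (hl : ∀ m, A (M.xl m) = N.xl (A m))
    (hr : ∀ m, A (M.xr m) = N.xr (A m)) (f : Poly) (m : M) :
    A (biact M f m) = biact N f (A m) := by
  induction f using MvPolynomial.induction_on with
  | C c => simp
  | add f g hf hg => simp only [map_add, LinearMap.add_apply, hf, hg]
  | mul_X f i hf => fin_cases i <;> simp [hl, hr, hf]

theorem chg_biact (f : Poly) (m : M) :
    M.chg (biact M f m) = biact M f (M.chg m) + (2 / d : ℂ) • biact M (euler f) m := by
  induction f using MvPolynomial.induction_on with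
  | C c => simp
  | add f g hf hg => simp only [map_add, LinearMap.add_apply, hf, hg, smul_add]; abel
  | mul_X f i hf =>
    fin_cases i <;>
      simp only [Fin.zero_eta, Fin.mk_one, Fin.isValue, biact_mul_X_zero, biact_mul_X_one,
        M.chg_xl, M.chg_xr, hf, map_add, map_smul, Derivation.leibniz, euler_X, smul_eq_mul,
        mul_comm _ (euler f), LinearMap.add_apply, smul_add] <;>
      abel

variable [NeZero d] (S : Finset (ZMod d))

@[simp] theorem el_zero : el S 0 0 = 0 := rfl

theorem neg_el (f g : Poly) : -el S f g = el S (-f) (-g) := rfl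

theorem sub_el (f f' g g' : Poly) : el S f g - el S f' g' = el S (f - f') (g - g') := rfl

@[simp] theorem biact_el (f u v : Poly) :
    biact (permFact S) f (el S u v) = el S (f * u) (f * v) := by
  induction f using MvPolynomial.induction_on with
  | C c => simp [smul_el, smul_eq_C_mul]
  | add f g hf hg => simp only [map_add, LinearMap.add_apply, hf, hg, add_el, add_mul]
  | mul_X f i hf =>
    fin_cases i <;>
      simp only [Fin.zero_eta, Fin.mk_one, Fin.isValue, biact_mul_X_zero, biact_mul_X_one, hf,
        xl_el, xr_el] <;>
      ring_nf

/-- The map of bigraded bimodules from `P_S` which sends the even generator to `e` and the odd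
generator to `o`. -/
def permLift (e o : N) : permFact S →ₗ[ℂ] N :=
  ((biact N).flip e).coprod ((biact N).flip o)

@[simp] theorem permLift_el (e o : N) (f g : Poly) :
    permLift S e o (el S f g) = biact N f e + biact N g o := rfl

theorem isGraded_permLift {e o : N} (par_e : N.par e = e) (par_o : N.par o = -o)
    (chg_e : N.chg e = ((1 - S.card) / d : ℂ) • e)
    (chg_o : N.chg o = ((S.card + 1) / d - 1 : ℂ) • o) : IsGraded (permLift S e o) := by
  refine ⟨fun t => ?_, fun t => ?_, fun t => ?_, fun t => ?_⟩ <;>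
    obtain ⟨f, g, rfl⟩ := exists_el S t
  · simp [mul_comm (X 0 : Poly)]
  · simp [mul_comm (X 1 : Poly)]
  · simp [biact_comm N.par N.par_xl N.par_xr, par_e, par_o]
  · simp only [chg_el, permLift_el, map_add, map_smul, LinearMap.add_apply,
      LinearMap.smul_apply, chg_biact, chg_e, chg_o]
    abel

theorem exists_graded_section {p : cycles N (permFact S)} {e o : N} (par_e : N.par e = e)
    (par_o : N.par o = -o) (chg_e : N.chg e = ((1 - S.card) / d : ℂ) • e)
    (chg_o : N.chg o = ((S.card + 1) / d - 1 : ℂ) • o) (pe : p.1 e = el S 1 0)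
    (po : p.1 o = el S 0 1) :
    ∃ s : permFact S →ₗ[ℂ] N, IsGraded s ∧ ∀ m, p.1 (s m) = m := by
  refine ⟨permLift S e o, isGraded_permLift S par_e par_o chg_e chg_o, fun m => ?_⟩
  obtain ⟨f, g, rfl⟩ := exists_el S m
  simp [biact_comm p.1 p.2.1 p.2.2.1, pe, po, add_el]

theorem exists_leftUnitor (M : Bifact d) : ∃ p : cycles (unitObj d ⊙ M) M,
    leftUnitor M = homMk p ∧ ∀ f g m, p.1 (el {0} f g ⊗ₚ m) = actL M f m :=
  ⟨_, rfl, fun f g m => by simp⟩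

theorem exists_rightUnitor (M : Bifact d) : ∃ p : cycles (M ⊙ unitObj d) M,
    rightUnitor M = homMk p ∧ ∀ m f g, p.1 (m ⊗ₚ el {0} f g) = actR M f m :=
  ⟨_, rfl, fun m f g => by simp⟩

/-- `f (x, y) ↦ f (t, t)`, where `t` is the `i`-th variable. -/
def restrictDiag (i : Fin 2) : Poly →ₐ[ℂ] Poly := rename fun _ => i

theorem X_sub_X_dvd_X_sub_X (i j : Fin 2) : (X 0 - X 1 : Poly) ∣ X j - X i := by
  fin_cases i <;> fin_cases j
  · simp
  · exact dvd_sub_comm.1 dvd_rfl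
  · exact dvd_rfl
  · simp

theorem X_sub_X_ne_zero : (X 0 - X 1 : Poly) ≠ 0 :=
  sub_ne_zero.2 fun h => absurd (X_injective h) (by decide)

theorem X_sub_X_dvd_sub_restrictDiag (i : Fin 2) (f : Poly) :
    (X 0 - X 1 : Poly) ∣ f - restrictDiag i f := by
  induction f using MvPolynomial.induction_on with
  | C c => simp [restrictDiag]
  | add f g hf hg => rw [map_add, add_sub_add_comm]; exact dvd_add hf hg
  | mul_X f j hf =>
    have e : f * X j - restrictDiag i (f * X j) =
        (f - restrictDiag i f) * X j + restrictDiag i f * (X j - X i) := by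
      simp only [restrictDiag, map_mul, rename_X]
      ring
    exact e ▸ dvd_add (hf.mul_right _) ((X_sub_X_dvd_X_sub_X i j).mul_left _)

theorem mulLeft_X_sub_X_injective :
    Function.Injective (LinearMap.mulLeft ℂ (X 0 - X 1 : Poly)) :=
  mul_right_injective₀ X_sub_X_ne_zero

/-- The divided difference `(f (x, y) - f (t, t)) / (x - y)`, where `t` is the `i`-th variable. -/
def divDiff (i : Fin 2) : Poly →ₗ[ℂ] Poly :=
  (LinearEquiv.ofInjective _ mulLeft_X_sub_X_injective).symm ∘ₗ
    LinearMap.codRestrict (LinearMap.range (LinearMap.mulLeft ℂ (X 0 - X 1 : Poly)))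
      (LinearMap.id - (restrictDiag i).toLinearMap) fun f => by
        obtain ⟨g, hg⟩ := X_sub_X_dvd_sub_restrictDiag i f
        exact ⟨g, hg.symm⟩

theorem X_sub_X_mul_divDiff (i : Fin 2) (f : Poly) :
    (X 0 - X 1) * divDiff i f = f - restrictDiag i f :=
  LinearEquiv.ofInjective_symm_apply _ (h := mulLeft_X_sub_X_injective) _

theorem divDiff_X_mul (i : Fin 2) (f : Poly) : divDiff i (X i * f) = X i * divDiff i f :=
  mul_left_cancel₀ X_sub_X_ne_zero <| by
    rw [mul_left_comm, X_sub_X_mul_divDiff, X_sub_X_mul_divDiff]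
    simp [restrictDiag, mul_sub]

theorem divDiff_X_sub_X_mul (i : Fin 2) (f : Poly) : divDiff i ((X 0 - X 1) * f) = f :=
  mul_left_cancel₀ X_sub_X_ne_zero <| by
    rw [X_sub_X_mul_divDiff]
    simp [restrictDiag]

theorem permProd_zero : permProd ({0} : Finset (ZMod d)) = X 0 - X 1 := by simp [permProd]

/-- The projection of the unit to its odd summand. -/
def unitOddProj (d : ℕ) [NeZero d] : unitObj d →ₗ[ℂ] unitObj d := permMap {0} {0} 0 LinearMap.id

@[simp] theorem unitOddProj_el (f g : Poly) : unitOddProj d (el {0} f g) = el {0} 0 g := rfl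

theorem isGraded_unitOddProj : IsGraded (unitOddProj d) where
  map_xl t := by obtain ⟨f, g, rfl⟩ := exists_el _ t; simp
  map_xr t := by obtain ⟨f, g, rfl⟩ := exists_el _ t; simp
  map_par t := by obtain ⟨f, g, rfl⟩ := exists_el _ t; simp
  map_chg t := by obtain ⟨f, g, rfl⟩ := exists_el _ t; simp

/-- The divided difference as a map from the even to the odd summand of the unit. -/
def unitDivDiff (d : ℕ) [NeZero d] (i : Fin 2) : unitObj d →ₗ[ℂ] unitObj d :=
  LinearMap.inr ℂ Poly Poly ∘ₗ divDiff i ∘ₗ evenPart {0}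

@[simp] theorem unitDivDiff_el (i : Fin 2) (f g : Poly) :
    unitDivDiff d i (el {0} f g) = el {0} 0 (divDiff i f) := rfl

theorem restrictDiag_one_tmul (f : Poly) (m : M) :
    el {(0 : ZMod d)} (restrictDiag 1 f) 0 ⊗ₚ m = el {0} 1 0 ⊗ₚ actL M f m := by
  induction f using MvPolynomial.induction_on generalizing m with
  | C c =>
    have e : el {(0 : ZMod d)} (C c) 0 = c • el {0} 1 0 := by simp [smul_el, smul_eq_C_mul]
    simp [restrictDiag, e]
  | add f g hf hg => simp [← hf, ← hg, ← add_tmul, add_el]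
  | mul_X f i hf =>
    rw [actL_mul_X, ← hf, ← xr_tmul]
    simp [restrictDiag, mul_comm]

theorem tmul_restrictDiag_zero (f : Poly) (m : M) :
    m ⊗ₚ el {(0 : ZMod d)} (restrictDiag 0 f) 0 = actR M f m ⊗ₚ el {0} 1 0 := by
  induction f using MvPolynomial.induction_on generalizing m with
  | C c =>
    have e : el {(0 : ZMod d)} (C c) 0 = c • el {0} 1 0 := by simp [smul_el, smul_eq_C_mul]
    simp [restrictDiag, e]
  | add f g hf hg => simp [← hf, ← hg, ← tmul_add, add_el]
  | mul_X f i hf =>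
    rw [actR_mul_X, ← hf, xr_tmul]
    simp [restrictDiag, mul_comm]

/-- The kernel of the left unitor is the odd summand of the unit and the multiples of `x - y` in
the even one. -/
def leftUnitorSplitting {p : cycles (unitObj d ⊙ M) M}
    (hp : ∀ f g m, p.1 (el {0} f g ⊗ₚ m) = actL M f m) : KernelSplitting p where
  Q := tensorMap (unitOddProj d) LinearMap.id isGraded_unitOddProj.map_xr fun _ => rfl
  K := tensorMap (unitDivDiff d 1) LinearMap.id (fun t => by
    obtain ⟨f, g, rfl⟩ := exists_el _ t
    simp [divDiff_X_mul]) fun _ => rfl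
  isGraded := by
    refine ⟨?_, ?_, ?_, ?_⟩ <;> intro t <;> induction t using tensor_induction with
      | add s t hs ht => simp only [map_add, hs, ht]
      | tmul t m => simp [isGraded_unitOddProj.map_xl, isGraded_unitOddProj.map_par,
          isGraded_unitOddProj.map_chg]
  p_Q c := by
    induction c using tensor_induction with
    | add s t hs ht => simp only [map_add, hs, ht, add_zero]
    | tmul t m => obtain ⟨f, g, rfl⟩ := exists_el _ t; simp [hp]
  Q_K c := by
    induction c using tensor_induction with
    | add s t hs ht => simp only [map_add, hs, ht]
    | tmul t m => obtain ⟨f, g, rfl⟩ := exists_el _ t; simp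
  K_Q c := by
    induction c using tensor_induction with
    | add s t hs ht => simp only [map_add, hs, ht, add_zero]
    | tmul t m => obtain ⟨f, g, rfl⟩ := exists_el _ t; simp [zero_tmul]
  K_diff_Q c := by
    induction c using tensor_induction with
    | add s t hs ht => simp only [map_add, hs, ht]
    | tmul t m =>
      obtain ⟨f, g, rfl⟩ := exists_el _ t
      simp [permProd_zero, divDiff_X_sub_X_mul, zero_tmul]
  diff_K c hc := by
    rw [← sub_zero (c - _), ← tmul_zero (el {(0 : ZMod d)} 1 0), ← hc]
    clear hc
    induction c using tensor_induction with
    | add s t hs ht => simp only [map_add, tmul_add, add_sub_add_comm, hs, ht]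
    | tmul t m =>
      obtain ⟨f, g, rfl⟩ := exists_el _ t
      have odd_zero : el {(0 : ZMod d)} f g - el {0} 0 g - el {0} (restrictDiag 1 f) 0 =
        el {0} (f - restrictDiag 1 f) 0 := by simp [sub_el]
      simp [hp, ← restrictDiag_one_tmul, ← sub_tmul, odd_zero, permProd_zero, X_sub_X_mul_divDiff,
        zero_tmul]

/-- The mirror image of `leftUnitorSplitting`. -/
def rightUnitorSplitting {p : cycles (M ⊙ unitObj d) M}
    (hp : ∀ m f g, p.1 (m ⊗ₚ el {0} f g) = actR M f m) : KernelSplitting p where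
  Q := tensorMap LinearMap.id (unitOddProj d) (fun _ => rfl) isGraded_unitOddProj.map_xl
  K := tensorMap M.par (unitDivDiff d 0) M.par_xr fun t => by
    obtain ⟨f, g, rfl⟩ := exists_el _ t
    simp [divDiff_X_mul]
  isGraded := by
    refine ⟨?_, ?_, ?_, ?_⟩ <;> intro t <;> induction t using tensor_induction with
      | add s t hs ht => simp only [map_add, hs, ht]
      | tmul t m => simp [isGraded_unitOddProj.map_xr, isGraded_unitOddProj.map_par,
          isGraded_unitOddProj.map_chg]
  p_Q c := by
    induction c using tensor_induction with
    | add s t hs ht => simp only [map_add, hs, ht, add_zero]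
    | tmul m t => obtain ⟨f, g, rfl⟩ := exists_el _ t; simp [hp]
  Q_K c := by
    induction c using tensor_induction with
    | add s t hs ht => simp only [map_add, hs, ht]
    | tmul m t => obtain ⟨f, g, rfl⟩ := exists_el _ t; simp
  K_Q c := by
    induction c using tensor_induction with
    | add s t hs ht => simp only [map_add, hs, ht, add_zero]
    | tmul m t => obtain ⟨f, g, rfl⟩ := exists_el _ t; simp [tmul_zero]
  K_diff_Q c := by
    induction c using tensor_induction with
    | add s t hs ht => simp only [map_add, hs, ht]
    | tmul m t =>
      obtain ⟨f, g, rfl⟩ := exists_el _ t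
      simp [permProd_zero, divDiff_X_sub_X_mul, tmul_zero, M.par_par]
  diff_K c hc := by
    rw [← sub_zero (c - _), ← zero_tmul (el {(0 : ZMod d)} 1 0), ← hc]
    clear hc
    induction c using tensor_induction with
    | add s t hs ht => simp only [map_add, add_tmul, add_sub_add_comm, hs, ht]
    | tmul m t =>
      obtain ⟨f, g, rfl⟩ := exists_el _ t
      have odd_zero : el {(0 : ZMod d)} f g - el {0} 0 g - el {0} (restrictDiag 0 f) 0 =
        el {0} (f - restrictDiag 0 f) 0 := by simp [sub_el]
      simp [hp, ← tmul_restrictDiag_zero, ← tmul_sub, odd_zero, permProd_zero, X_sub_X_mul_divDiff,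
        tmul_zero, M.par_par]

theorem par_oddGen : (permFact S).par (el S 0 1) = -el S 0 1 := by simp [neg_el]

theorem chg_evenGen : (permFact S).chg (el S 1 0) = ((1 - S.card) / d : ℂ) • el S 1 0 := by
  simp [smul_el]

theorem chg_oddGen :
    (permFact S).chg (el S 0 1) = ((S.card + 1) / d - 1 : ℂ) • el S 0 1 := by
  simp [smul_el]

theorem chg_unit : (unitObj d).chg (el {0} 1 0) = 0 := by simp

instance : IsIso (leftUnitor (permFact S)) := by
  obtain ⟨p, e, hp⟩ := exists_leftUnitor (permFact S)
  have p_one (m : permFact S) : p.1 (el {0} 1 0 ⊗ₚ m) = m := by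
    rw [hp, ← MvPolynomial.C_1, actL_C, one_smul]
  obtain ⟨s, hs, ps⟩ := exists_graded_section S (e := el {0} 1 0 ⊗ₚ el S 1 0)
    (o := el {0} 1 0 ⊗ₚ el S 0 1) (by simp) (by rw [par_tmul, par_oddGen]; simp)
    (by rw [chg_tmul, chg_unit, chg_evenGen, zero_tmul, zero_add, tmul_smul])
    (by rw [chg_tmul, chg_unit, chg_oddGen, zero_tmul, zero_add, tmul_smul])
    (p_one _) (p_one _)
  exact e ▸ (leftUnitorSplitting hp).isIso_homMk hs ps

instance : IsIso (rightUnitor (permFact S)) := by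
  obtain ⟨p, e, hp⟩ := exists_rightUnitor (permFact S)
  have p_one (m : permFact S) : p.1 (m ⊗ₚ el {0} 1 0) = m := by
    rw [hp, ← MvPolynomial.C_1, actR_C, one_smul]
  obtain ⟨s, hs, ps⟩ := exists_graded_section S (e := el S 1 0 ⊗ₚ el {0} 1 0)
    (o := el S 0 1 ⊗ₚ el {0} 1 0) (by simp) (by rw [par_tmul, par_oddGen]; simp)
    (by rw [chg_tmul, chg_unit, chg_evenGen, tmul_zero, add_zero, smul_tmul])
    (by rw [chg_tmul, chg_unit, chg_oddGen, tmul_zero, add_zero, smul_tmul])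
    (p_one _) (p_one _)
  exact e ▸ (rightUnitorSplitting hp).isIso_homMk hs ps

instance isIso_psiL (a : ZMod d) {S T : Finset (ZMod d)} (h : T = shiftSet S a) :
    IsIso (psiL a h) := by
  unfold psiL
  infer_instance

instance isIso_psiR (a : ZMod d) {S T : Finset (ZMod d)} (h : T = shiftSet S a) :
    IsIso (psiR a h) := by
  unfold psiR
  infer_instance

end Unitors

section Twists

variable {d : ℕ} {M N P : Bifact d}

theorem tensor_induction_left {p : ((M ⊙ N) ⊙ P : Bifact d) → Prop} (t : ((M ⊙ N) ⊙ P : Bifact d))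
    (tmul : ∀ m n q, p ((m ⊗ₚ n) ⊗ₚ q)) (add : ∀ s t, p s → p t → p (s + t)) : p t := by
  induction t using tensor_induction with
  | add s t hs ht => exact add s t hs ht
  | tmul t q =>
    induction t using tensor_induction with
    | tmul m n => exact tmul m n q
    | add s t hs ht => exact add_tmul s t q ▸ add _ _ hs ht

theorem tensor_induction_right {p : (M ⊙ (N ⊙ P) : Bifact d) → Prop}
    (t : (M ⊙ (N ⊙ P) : Bifact d)) (tmul : ∀ m n q, p (m ⊗ₚ (n ⊗ₚ q)))
    (add : ∀ s t, p s → p t → p (s + t)) : p t := by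
  induction t using tensor_induction with
  | add s t hs ht => exact add s t hs ht
  | tmul m t =>
    induction t using tensor_induction with
    | tmul n q => exact tmul m n q
    | add s t hs ht => exact tmul_add m s t ▸ add _ _ hs ht

theorem exists_associator (M N P : Bifact d) :
    ∃ p : cycles ((M ⊙ N) ⊙ P) (M ⊙ (N ⊙ P)), (associator M N P).hom = homMk p ∧
      ∀ m n q, p.1 ((m ⊗ₚ n) ⊗ₚ q) = m ⊗ₚ (n ⊗ₚ q) :=
  ⟨_, rfl, fun m n q => by simp⟩

theorem exists_associator_inv (M N P : Bifact d) :
    ∃ p : cycles (M ⊙ (N ⊙ P)) ((M ⊙ N) ⊙ P), (associator M N P).inv = homMk p ∧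
      ∀ m n q, p.1 (m ⊗ₚ (n ⊗ₚ q)) = (m ⊗ₚ n) ⊗ₚ q :=
  ⟨_, rfl, fun m n q => by simp⟩

theorem actL_mul (f g : Poly) (m : M) : actL M (f * g) m = actL M f (actL M g m) := by
  simp [actL]

theorem actL_congr {f g : Poly} (h : diagonal f = diagonal g) (m : M) :
    actL M f m = actL M g m :=
  congrArg (fun p => Polynomial.aeval M.xl p m) h

theorem actR_mul (f g : Poly) (m : M) : actR M (f * g) m = actR M f (actR M g m) := by
  simp [actR]

theorem actL_actR (f g : Poly) (m : M) : actL M f (actR M g m) = actR M g (actL M f m) :=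
  actL_comm (actR M g) (fun m => actR_comm M.xl M.xl_xr g m) f m

theorem actL_tmul (f : Poly) (m : M) (n : N) : actL (M ⊙ N) f (m ⊗ₚ n) = actL M f m ⊗ₚ n :=
  actL_comm ((tmulL M N).flip n) (fun m => (xl_tmul m n).symm) f m

theorem actR_tmul (f : Poly) (m : M) (n : N) : actR (M ⊙ N) f (m ⊗ₚ n) = m ⊗ₚ actR N f n :=
  actR_comm (tmulL M N m) (fun n => (tmul_xr m n).symm) f n

theorem actR_tmul_eq_tmul_actL (f : Poly) (m : M) (n : N) :
    actR M f m ⊗ₚ n = m ⊗ₚ actL N f n := by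
  induction f using MvPolynomial.induction_on generalizing m n with
  | C c => simp
  | add f g hf hg => simp [hf, hg]
  | mul_X f i hf => rw [actR_mul_X, hf, xr_tmul, ← actL_comm N.xl fun _ => rfl, actL_mul_X]

theorem scale_comp (u v u' v' : ℂ) (f : Poly) :
    scale u v (scale u' v' f) = scale (u * u') (v * v') f := by
  have e : (scale u v).comp (scale u' v') = scale (u * u') (v * v') :=
    MvPolynomial.algHom_ext fun i => by
      fin_cases i <;>
        simp only [Fin.zero_eta, Fin.mk_one, Fin.isValue, AlgHom.coe_comp, Function.comp_apply,
          scale_X_zero, scale_X_one, map_mul, MvPolynomial.algHom_C,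
          MvPolynomial.algebraMap_eq] <;>
        ring
  exact DFunLike.congr_fun e f

theorem scale_one (f : Poly) : scale 1 1 f = f := by
  have e : scale 1 1 = AlgHom.id ℂ Poly :=
    MvPolynomial.algHom_ext fun i => by fin_cases i <;> simp
  exact DFunLike.congr_fun e f

variable [NeZero d]

theorem etaPow_mul_etaPow_neg (a : ZMod d) : etaPow a * etaPow (-a) = 1 := by
  rw [← AddChar.map_add_eq_mul, add_neg_cancel, AddChar.map_zero_eq_one]

theorem actL_twist (a b : ZMod d) (f : Poly) (m : M) :
    actL (twist a b M) f (toTwist a b M m) =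
      toTwist a b M (actL M (scale (etaPow (-a)) (etaPow (-a)) f) m) := by
  induction f using MvPolynomial.induction_on generalizing m with
  | C c => simp
  | add f g hf hg => simp [hf, hg]
  | mul_X f i hf =>
    fin_cases i <;> simp [hf, mul_left_comm _ (MvPolynomial.C _), actL_mul (MvPolynomial.C _)]

theorem actR_twist (a b : ZMod d) (f : Poly) (m : M) :
    actR (twist a b M) f (toTwist a b M m) =
      toTwist a b M (actR M (scale (etaPow b) (etaPow b) f) m) := by
  induction f using MvPolynomial.induction_on generalizing m with
  | C c => simp
  | add f g hf hg => simp [hf, hg]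
  | mul_X f i hf =>
    fin_cases i <;> simp [hf, mul_left_comm _ (MvPolynomial.C _), actR_mul (MvPolynomial.C _)]

/-- A chain map is also a chain map between twists. -/
def twistCycle (a b : ZMod d) (f : cycles M N) : cycles (twist a b M) (twist a b N) :=
  ⟨toTwist a b N ∘ₗ f.1 ∘ₗ ofTwist a b M, by
    obtain ⟨f, f_xl, f_xr, f_par, f_chg, f_diff⟩ := f
    refine ⟨?_, ?_, ?_, ?_, ?_⟩ <;> intro t <;> obtain ⟨m, hm⟩ := exists_toTwist _ _ _ t <;>
      rw [hm] <;> simp [f_xl, f_xr, f_par, f_chg, f_diff]⟩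

@[simp] theorem twistCycle_toTwist (a b : ZMod d) (f : cycles M N) (m : M) :
    (twistCycle a b f).1 (toTwist a b M m) = toTwist a b N (f.1 m) := rfl

theorem toTwist_xr_tmul {a b b' c : ZMod d} (h : b + b' = 0) (m : M) (n : N) :
    toTwist a b M (M.xr m) ⊗ₚ toTwist b' c N n = toTwist a b M m ⊗ₚ toTwist b' c N (N.xl n) := by
  obtain rfl := neg_eq_of_add_eq_zero_right h
  have e := congrArg (etaPow (-b) • ·) (xr_tmul (toTwist a b M m) (toTwist (-b) c N n))
  simpa [smul_smul, mul_comm (etaPow (-b)), etaPow_mul_etaPow_neg] using e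

theorem twist_tensor_induction {a b b' c : ZMod d}
    {p : (twist a b M ⊙ twist b' c N : Bifact d) → Prop}
    (t : (twist a b M ⊙ twist b' c N : Bifact d))
    (tmul : ∀ m n, p (toTwist a b M m ⊗ₚ toTwist b' c N n))
    (add : ∀ s t, p s → p t → p (s + t)) : p t :=
  tensor_induction t (fun m n => tmul (ofTwist a b M m) (ofTwist b' c N n)) add

/-- The map `M N → _a M_b ⊗ _{-b} N_c` which is the identity on pure tensors. -/
def toTensorTwist (a b b' c : ZMod d) (h : b + b' = 0) (M N : Bifact d) :
    (M ⊙ N : Bifact d) →ₗ[ℂ] (twist a b M ⊙ twist b' c N : Bifact d) :=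
  tensorLift ((tmulL (twist a b M) (twist b' c N)).compl₁₂ (toTwist a b M) (toTwist b' c N))
    (toTwist_xr_tmul h)

@[simp] theorem toTensorTwist_tmul (a b b' c : ZMod d) (h : b + b' = 0) (m : M) (n : N) :
    toTensorTwist a b b' c h M N (m ⊗ₚ n) = toTwist a b M m ⊗ₚ toTwist b' c N n :=
  tensorLift_tmul _ _ m n

/-- The map `_a M_b ⊗ _{-b} N_c → M N` which is the identity on pure tensors. -/
def ofTensorTwist (a b b' c : ZMod d) (h : b + b' = 0) (M N : Bifact d) :
    (twist a b M ⊙ twist b' c N : Bifact d) →ₗ[ℂ] (M ⊙ N : Bifact d) :=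
  tensorLift ((tmulL M N).compl₁₂ (ofTwist a b M) (ofTwist b' c N)) (by
    obtain rfl := neg_eq_of_add_eq_zero_right h
    intro s t
    obtain ⟨m, hm⟩ := exists_toTwist _ _ _ s
    obtain ⟨n, hn⟩ := exists_toTwist _ _ _ t
    rw [hm, hn]
    simp [xr_tmul])

@[simp] theorem ofTensorTwist_tmul (a b b' c : ZMod d) (h : b + b' = 0) (m : M) (n : N) :
    ofTensorTwist a b b' c h M N (toTwist a b M m ⊗ₚ toTwist b' c N n) = m ⊗ₚ n := by
  simp [ofTensorTwist]

/-- The identification `_a M_b ⊗ _{-b} N_c = _a (M N)_c`, which is the identity on pure tensors. -/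
def twistTensor (a b b' c : ZMod d) (h : b + b' = 0) (M N : Bifact d) :
    twist a b M ⊙ twist b' c N ≅ twist a c (M ⊙ N) :=
  isoMk
    ⟨toTwist a c (M ⊙ N) ∘ₗ ofTensorTwist a b b' c h M N, by
      refine ⟨?_, ?_, ?_, ?_, ?_⟩ <;> intro t <;> induction t using twist_tensor_induction with
        | add s t hs ht => simp only [map_add, hs, ht]
        | tmul m n => simp⟩
    (toTensorTwist a b b' c h M N ∘ₗ ofTwist a c (M ⊙ N))
    (fun (t : (twist a b M ⊙ twist b' c N : Bifact d)) => by
      change toTensorTwist a b b' c h M N (ofTensorTwist a b b' c h M N t) = t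
      induction t using twist_tensor_induction with
      | add s t hs ht => simp only [map_add, hs, ht]
      | tmul m n => rw [ofTensorTwist_tmul, toTensorTwist_tmul])
    (fun (t : (M ⊙ N : Bifact d)) => by
      change ofTensorTwist a b b' c h M N (toTensorTwist a b b' c h M N t) = t
      induction t using tensor_induction with
      | add s t hs ht => simp only [map_add, hs, ht]
      | tmul m n => rw [toTensorTwist_tmul, ofTensorTwist_tmul])

theorem exists_twistTensor (a b b' c : ZMod d) (h : b + b' = 0) (M N : Bifact d) :
    ∃ p : cycles (twist a b M ⊙ twist b' c N) (twist a c (M ⊙ N)),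
      (twistTensor a b b' c h M N).hom = homMk p ∧
      ∀ m n, p.1 (toTwist a b M m ⊗ₚ toTwist b' c N n) = toTwist a c (M ⊙ N) (m ⊗ₚ n) :=
  ⟨_, rfl, fun m n => by simp⟩

theorem exists_untwist (a b : ZMod d) {S T : Finset (ZMod d)} (h : T = shiftSet S (-a - b)) :
    ∃ p : cycles (permFact T) (twist a b (permFact S)), (untwist a b h).hom = homMk p ∧
      ∀ f g, p.1 (el T f g) = toTwist a b _ (el S (scale (etaPow (-a)) (etaPow b) f)
        (etaPow (-((S.card : ZMod d) * a)) • scale (etaPow (-a)) (etaPow b) g)) :=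
  ⟨_, rfl, fun f g => by simp⟩

theorem exists_untwist_inv (a b : ZMod d) {S T : Finset (ZMod d)} (h : T = shiftSet S (-a - b)) :
    ∃ p : cycles (twist a b (permFact S)) (permFact T), (untwist a b h).inv = homMk p ∧
      ∀ f g, p.1 (toTwist a b _ (el S f g)) = el T (scale (etaPow a) (etaPow (-b)) f)
        (etaPow ((S.card : ZMod d) * a) • scale (etaPow a) (etaPow (-b)) g) :=
  ⟨_, rfl, fun f g => by simp⟩

theorem leftUnitor_naturality (φ : M ⟶ N) :
    (𝟙 (unitObj d) ⊙ₘ φ) ≫ leftUnitor N = leftUnitor M ≫ φ := by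
  obtain ⟨f, rfl⟩ := exists_homMk φ
  obtain ⟨p, hp, p_tmul⟩ := exists_leftUnitor M
  obtain ⟨q, hq, q_tmul⟩ := exists_leftUnitor N
  rw [hp, hq, homMk_id, homMk_tensor, homMk_comp, homMk_comp]
  refine homMk_congr_tmul fun t m => ?_
  obtain ⟨u, v, rfl⟩ := exists_el _ t
  simp [p_tmul, q_tmul, actL_comm f.1 f.2.1]

theorem rightUnitor_naturality (φ : M ⟶ N) :
    (φ ⊙ₘ 𝟙 (unitObj d)) ≫ rightUnitor N = rightUnitor M ≫ φ := by
  obtain ⟨f, rfl⟩ := exists_homMk φ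
  obtain ⟨p, hp, p_tmul⟩ := exists_rightUnitor M
  obtain ⟨q, hq, q_tmul⟩ := exists_rightUnitor N
  rw [hp, hq, homMk_id, homMk_tensor, homMk_comp, homMk_comp]
  refine homMk_congr_tmul fun m t => ?_
  obtain ⟨u, v, rfl⟩ := exists_el _ t
  simp [p_tmul, q_tmul, actR_comm f.1 f.2.2.1]

/-- The morphism `a M → _{-a} M` obtained from `s_{0,-a}` and the left unitor. -/
def lineTwistL (a : ZMod d) (M : Bifact d) : line a ⊙ M ⟶ twist (-a) 0 M :=
  ((untwist 0 (-a) (S := {0}) (T := {a}) (by simp [shiftSet])).hom ⊙ₘ 𝟙 M) ≫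
    (twistMiddle (-a) (unitObj d) M).hom ≫ leftUnitor (twist (-a) 0 M)

/-- The morphism `M a → M_{-a}` obtained from `s_{-a,0}` and the right unitor. -/
def lineTwistR (a : ZMod d) (M : Bifact d) : M ⊙ line a ⟶ twist 0 (-a) M :=
  (𝟙 M ⊙ₘ (untwist (-a) 0 (S := {0}) (T := {a}) (by simp [shiftSet])).hom) ≫
    (twistMiddle (-a) M (unitObj d)).inv ≫ rightUnitor (twist 0 (-a) M)

theorem exists_lineTwistL (a : ZMod d) (M : Bifact d) :
    ∃ p : cycles (line a ⊙ M) (twist (-a) 0 M), lineTwistL a M = homMk p ∧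
      ∀ f g m, p.1 (el {a} f g ⊗ₚ m) = toTwist _ _ M (actL M (scale (etaPow a) 1 f) m) := by
  refine ⟨_, rfl, fun f g m => ?_⟩
  have e : actL (twist (-a) 0 M) (scale (etaPow (-0 : ZMod d)) (etaPow (-a)) f)
      (toTwist (-a) 0 M m) = toTwist _ _ M (actL M (scale (etaPow a) 1 f) m) := by
    rw [actL_twist, scale_comp]
    simp [etaPow_mul_etaPow_neg]
  rw [← e]
  simp [cyclesComp, cyclesTensor]

theorem exists_lineTwistR (a : ZMod d) (M : Bifact d) :
    ∃ p : cycles (M ⊙ line a) (twist 0 (-a) M), lineTwistR a M = homMk p ∧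
      ∀ m f g, p.1 (m ⊗ₚ el {a} f g) = toTwist _ _ M (actR M (scale 1 (etaPow (-a)) f) m) := by
  refine ⟨_, rfl, fun m f g => ?_⟩
  have e : actR (twist 0 (-a) M) (scale (etaPow (- -a)) (etaPow (0 : ZMod d)) f)
      (toTwist 0 (-a) M m) = toTwist _ _ M (actR M (scale 1 (etaPow (-a)) f) m) := by
    rw [actR_twist, scale_comp]
    simp [etaPow_mul_etaPow_neg, mul_comm (etaPow (-a))]
  rw [← e]
  simp [cyclesComp, cyclesTensor]

theorem lineTwistL_naturality (a : ZMod d) (f : cycles M N) :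
    (𝟙 (line a) ⊙ₘ homMk f) ≫ lineTwistL a N =
      lineTwistL a M ≫ homMk (twistCycle (-a) 0 f) := by
  obtain ⟨p, hp, p_tmul⟩ := exists_lineTwistL a M
  obtain ⟨q, hq, q_tmul⟩ := exists_lineTwistL a N
  rw [hp, hq, homMk_id, homMk_tensor, homMk_comp, homMk_comp]
  refine homMk_congr_tmul fun t m => ?_
  obtain ⟨u, v, rfl⟩ := exists_el _ t
  simp [p_tmul, q_tmul, actL_comm f.1 f.2.1]

theorem lineTwistR_naturality (a : ZMod d) (f : cycles M N) :
    (homMk f ⊙ₘ 𝟙 (line a)) ≫ lineTwistR a N =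
      lineTwistR a M ≫ homMk (twistCycle 0 (-a) f) := by
  obtain ⟨p, hp, p_tmul⟩ := exists_lineTwistR a M
  obtain ⟨q, hq, q_tmul⟩ := exists_lineTwistR a N
  rw [hp, hq, homMk_id, homMk_tensor, homMk_comp, homMk_comp]
  refine homMk_congr_tmul fun m t => ?_
  obtain ⟨u, v, rfl⟩ := exists_el _ t
  simp [p_tmul, q_tmul, actR_comm f.1 f.2.2.1]

theorem psiL_eq (a : ZMod d) {S T : Finset (ZMod d)} (h : T = shiftSet S a) :
    psiL a h = lineTwistL a (permFact S) ≫
      (untwist (-a) 0 (S := S) (T := T) (by simpa using h)).inv := by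
  rw [psiL, leftUnitor_naturality, lineTwistL, Category.assoc, Category.assoc]

theorem psiR_eq (a : ZMod d) {S T : Finset (ZMod d)} (h : T = shiftSet S a) :
    psiR a h = lineTwistR a (permFact S) ≫
      (untwist 0 (-a) (S := S) (T := T) (by simpa using h)).inv := by
  rw [psiR, rightUnitor_naturality, lineTwistR, Category.assoc, Category.assoc]

instance (a : ZMod d) (S : Finset (ZMod d)) : IsIso (lineTwistL a (permFact S)) := by
  have e : lineTwistL a (permFact S) = psiL a rfl ≫
      (untwist (-a) 0 (S := S) (T := shiftSet S a) (by simp)).hom := by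
    rw [psiL_eq, Category.assoc, Iso.inv_hom_id, Category.comp_id]
  rw [e]
  infer_instance

instance (a : ZMod d) (S : Finset (ZMod d)) : IsIso (lineTwistR a (permFact S)) := by
  have e : lineTwistR a (permFact S) = psiR a rfl ≫
      (untwist 0 (-a) (S := S) (T := shiftSet S a) (by simp)).hom := by
    rw [psiR_eq, Category.assoc, Iso.inv_hom_id, Category.comp_id]
  rw [e]
  infer_instance

end Twists

section Sandwich

variable {d : ℕ} [NeZero d] {M N : Bifact d}

/-- Iterated twists add up. -/
def twistTwist {a a' a'' b b' b'' : ZMod d} (ha : a + a' = a'') (hb : b + b' = b'')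
    (M : Bifact d) : cycles (twist a b (twist a' b' M)) (twist a'' b'' M) :=
  ⟨toTwist a'' b'' M ∘ₗ ofTwist a' b' M ∘ₗ ofTwist a b (twist a' b' M), by
    subst ha hb
    refine ⟨?_, ?_, ?_, ?_, ?_⟩ <;> intro t <;> obtain ⟨s, hs⟩ := exists_toTwist _ _ _ t <;>
      obtain ⟨m, hm⟩ := exists_toTwist _ _ _ s <;> rw [hs, hm] <;>
      simp [AddChar.map_add_eq_mul, smul_smul, mul_comm]⟩

@[simp] theorem twistTwist_toTwist {a a' a'' b b' b'' : ZMod d} (ha : a + a' = a'')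
    (hb : b + b' = b'') (m : M) :
    (twistTwist ha hb M).1 (toTwist a b _ (toTwist a' b' M m)) = toTwist a'' b'' M m := rfl

/-- The morphism `(a M) (-a) → _{-a} M_a`. -/
def sandwich (a : ZMod d) (M : Bifact d) :
    (line a ⊙ M) ⊙ line (-a) ⟶ twist (-a) (- -a) M :=
  (lineTwistL a M ⊙ₘ 𝟙 (line (-a))) ≫ lineTwistR (-a) (twist (-a) 0 M) ≫
    homMk (twistTwist (zero_add (-a)) (add_zero (- -a)) M)

theorem exists_sandwich (a : ZMod d) (M : Bifact d) :
    ∃ p : cycles ((line a ⊙ M) ⊙ line (-a)) (twist (-a) (- -a) M), sandwich a M = homMk p ∧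
      ∀ f g m f' g', p.1 ((el {a} f g ⊗ₚ m) ⊗ₚ el {-a} f' g') = toTwist _ _ M
        (actR M (scale 1 (etaPow a) f') (actL M (scale (etaPow a) 1 f) m)) := by
  obtain ⟨l, hl, l_tmul⟩ := exists_lineTwistL a M
  obtain ⟨r, hr, r_tmul⟩ := exists_lineTwistR (-a) (twist (-a) 0 M)
  rw [sandwich, hl, hr, homMk_id, homMk_tensor, homMk_comp, homMk_comp]
  refine ⟨_, rfl, fun f g m f' g' => ?_⟩
  simp only [cyclesComp_apply, cyclesTensor_tmul, cyclesId_apply, l_tmul, r_tmul, actR_twist,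
    AddChar.map_zero_eq_one, scale_one, twistTwist_toTwist, neg_neg]

theorem sandwich_naturality (a : ZMod d) (f : cycles M N) :
    ((𝟙 (line a) ⊙ₘ homMk f) ⊙ₘ 𝟙 (line (-a))) ≫ sandwich a N =
      sandwich a M ≫ homMk (twistCycle (-a) (- -a) f) := by
  obtain ⟨p, hp, p_tmul⟩ := exists_sandwich a M
  obtain ⟨q, hq, q_tmul⟩ := exists_sandwich a N
  rw [hp, hq, homMk_id, homMk_id, homMk_tensor, homMk_tensor, homMk_comp, homMk_comp]
  refine homMk_congr fun t => ?_
  induction t using tensor_induction_left with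
  | add s t hs ht => simp only [map_add, hs, ht]
  | tmul u m v =>
    obtain ⟨g, h, rfl⟩ := exists_el _ u
    obtain ⟨g', h', rfl⟩ := exists_el _ v
    simp only [cyclesComp_apply, cyclesTensor_tmul, cyclesId_apply, p_tmul, q_tmul,
      twistCycle_toTwist, actL_comm f.1 f.2.1, actR_comm f.1 f.2.2.1]

theorem associator_inv_comp_sandwich (a : ZMod d) (M : Bifact d) :
    (associator (line a) M (line (-a))).inv ≫ sandwich a M =
      (𝟙 (line a) ⊙ₘ lineTwistR (-a) M) ≫ lineTwistL a (twist 0 (- -a) M) ≫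
        homMk (twistTwist (add_zero (-a)) (zero_add (- -a)) M) := by
  obtain ⟨s, hs, s_tmul⟩ := exists_associator_inv (line a) M (line (-a))
  obtain ⟨p, hp, p_tmul⟩ := exists_sandwich a M
  obtain ⟨r, hr, r_tmul⟩ := exists_lineTwistR (-a) M
  obtain ⟨l, hl, l_tmul⟩ := exists_lineTwistL a (twist 0 (- -a) M)
  rw [hs, hp, hr, hl, homMk_id, homMk_tensor, homMk_comp, homMk_comp, homMk_comp]
  refine homMk_congr fun t => ?_
  induction t using tensor_induction_right with
  | add s t hs ht => simp only [map_add, hs, ht]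
  | tmul u m v =>
    obtain ⟨f, g, rfl⟩ := exists_el _ u
    obtain ⟨f', g', rfl⟩ := exists_el _ v
    simp only [cyclesComp_apply, cyclesTensor_tmul, cyclesId_apply, s_tmul, p_tmul, l_tmul, r_tmul,
      actL_twist, neg_zero, AddChar.map_zero_eq_one, scale_one, twistTwist_toTwist, neg_neg,
      actL_actR]

theorem exists_untwist_inv_twistCycle {a a' a'' b b' b'' : ZMod d} (ha : a + a' = a'')
    (hb : b + b' = b'') {S T U : Finset (ZMod d)} (hT : T = shiftSet S (-a' - b'))
    (hU : U = shiftSet T (-a - b)) (hU' : U = shiftSet S (-a'' - b'')) :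
    ∃ z : cycles (twist a' b' (permFact S)) (permFact T), (untwist a' b' hT).inv = homMk z ∧
      homMk (twistCycle a b z) ≫ (untwist a b hU).inv ≫ (untwist a'' b'' hU').hom =
        homMk (twistTwist ha hb (permFact S)) := by
  obtain ⟨z, hz, z_el⟩ := exists_untwist_inv a' b' hT
  obtain ⟨w, hw, w_el⟩ := exists_untwist_inv a b hU
  obtain ⟨s, hs, s_el⟩ := exists_untwist a'' b'' hU'
  refine ⟨z, hz, ?_⟩
  rw [hw, hs]
  have cancel (m : permFact S) : s.1 (w.1 (toTwist a b _ (z.1 (toTwist a' b' _ m)))) =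
      toTwist a'' b'' _ m := by
    obtain ⟨f, g, rfl⟩ := exists_el S m
    subst ha hb hT
    have hb : b + b' + (-b + -b') = 0 := by ring
    have hS : -((S.card : ZMod d) * (a + a')) + (S.card * a + S.card * a') = 0 := by ring
    simp only [z_el, w_el, s_el, scale_comp, map_smul, smul_smul, ← AddChar.map_add_eq_mul,
      card_shiftSet, neg_add_cancel, hb, hS, AddChar.map_zero_eq_one, scale_one, one_smul]
  exact homMk_congr fun t => cancel (ofTwist a' b' _ (ofTwist a b _ t))

/-- The isomorphism `s_{-a,a}` of `P_S` with its own twist. -/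
def selfTwist (a : ZMod d) (S : Finset (ZMod d)) : permFact S ≅ twist (-a) (- -a) (permFact S) :=
  untwist (-a) (- -a) (S := S) (T := S) (by simp [shiftSet])

theorem psiL_comp_psiR (a : ZMod d) (S : Finset (ZMod d)) :
    (psiL a (S := S) (T := shiftSet S a) rfl ⊙ₘ 𝟙 (line (-a))) ≫
      psiR (-a) (S := shiftSet S a) (T := S) (shiftSet_neg S a) ≫ (selfTwist a S).hom =
        sandwich a (permFact S) := by
  obtain ⟨z, hz, e⟩ := exists_untwist_inv_twistCycle (zero_add (-a)) (add_zero (- -a))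
    (S := S) (T := shiftSet S a) (U := S) (by simp) (by simpa using shiftSet_neg S a)
    (by simp [shiftSet])
  rw [psiL_eq, psiR_eq, hz, selfTwist, Category.assoc, ← Category.comp_id (𝟙 (line (-a))),
    ← tensorHom_comp, Category.assoc, reassoc_of% lineTwistR_naturality (-a) z, e, sandwich]

theorem psiR_comp_psiL (a : ZMod d) (S : Finset (ZMod d)) :
    (𝟙 (line a) ⊙ₘ psiR (-a) (S := S) (T := shiftSet S (-a)) rfl) ≫
      psiL a (S := shiftSet S (-a)) (T := S) (shiftSet_neg' S a) ≫ (selfTwist a S).hom =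
        (associator (line a) (permFact S) (line (-a))).inv ≫ sandwich a (permFact S) := by
  obtain ⟨z, hz, e⟩ := exists_untwist_inv_twistCycle (add_zero (-a)) (zero_add (- -a))
    (S := S) (T := shiftSet S (-a)) (U := S) (by simp) (by simpa using shiftSet_neg' S a)
    (by simp [shiftSet])
  rw [psiL_eq, psiR_eq, hz, selfTwist, Category.assoc, ← Category.comp_id (𝟙 (line a)),
    ← tensorHom_comp, Category.assoc, reassoc_of% lineTwistL_naturality a z, e,
    associator_inv_comp_sandwich]

theorem sandwich_tensorObj (a : ZMod d) (M N : Bifact d) :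
    sandwich a (M ⊙ N) = ((associator (line a) M N).inv ⊙ₘ 𝟙 (line (-a))) ≫
      (associator (line a ⊙ M) N (line (-a))).hom ≫ (lineTwistL a M ⊙ₘ lineTwistR (-a) N) ≫
        (twistTensor (-a) 0 0 (- -a) (add_zero 0) M N).hom := by
  obtain ⟨s, hs, s_tmul⟩ := exists_sandwich a (M ⊙ N)
  obtain ⟨p, hp, p_tmul⟩ := exists_associator_inv (line a) M N
  obtain ⟨q, hq, q_tmul⟩ := exists_associator (line a ⊙ M) N (line (-a))
  obtain ⟨l, hl, l_tmul⟩ := exists_lineTwistL a M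
  obtain ⟨r, hr, r_tmul⟩ := exists_lineTwistR (-a) N
  obtain ⟨t, ht, t_tmul⟩ := exists_twistTensor (-a) 0 0 (- -a) (add_zero 0) M N
  rw [hs, hp, hq, hl, hr, ht, homMk_id, homMk_tensor, homMk_tensor, homMk_comp, homMk_comp,
    homMk_comp]
  refine homMk_congr_tmul fun u v => ?_
  obtain ⟨f', g', rfl⟩ := exists_el _ v
  induction u using tensor_induction_right with
  | add s t hs ht => simp only [add_tmul, map_add, hs, ht]
  | tmul u m n =>
    obtain ⟨f, g, rfl⟩ := exists_el _ u
    simp only [cyclesComp_apply, cyclesTensor_tmul, cyclesId_apply, s_tmul, p_tmul, q_tmul, l_tmul,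
      r_tmul, t_tmul, actL_tmul, actR_tmul, neg_neg]

instance (a : ZMod d) (S S' : Finset (ZMod d)) :
    IsIso (sandwich a (permFact S ⊙ permFact S')) := by
  rw [sandwich_tensorObj]
  infer_instance

theorem conjL_comp_sandwich (a : ZMod d) (S : Finset (ZMod d)) :
    conjL a S ≫ sandwich a (permFact S) = (selfTwist a S).hom := by
  rw [conjL, ← psiL_comp_psiR, Category.assoc, reassoc_of% tensorHom_comp, IsIso.inv_hom_id,
    Category.comp_id, tensorHom_id, Category.id_comp, IsIso.inv_hom_id_assoc]

theorem conjR_comp_sandwich (a : ZMod d) (S : Finset (ZMod d)) :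
    conjR a S ≫ (associator (line a) (permFact S) (line (-a))).inv ≫ sandwich a (permFact S) =
      (selfTwist a S).hom := by
  rw [conjR, ← psiR_comp_psiL, Category.assoc, reassoc_of% tensorHom_comp, IsIso.inv_hom_id,
    Category.comp_id, tensorHom_id, Category.id_comp, IsIso.inv_hom_id_assoc]

theorem actL_el (S : Finset (ZMod d)) (f u v : Poly) :
    actL (permFact S) f (el S u v) = el S (restrictDiag 0 f * u) (restrictDiag 0 f * v) := by
  induction f using MvPolynomial.induction_on generalizing u v with
  | C c => simp [restrictDiag, smul_el, MvPolynomial.smul_eq_C_mul]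
  | add f g hf hg => simp [hf, hg, add_el, add_mul]
  | mul_X f i hf => simp [hf, restrictDiag, mul_left_comm, mul_assoc]

theorem diagonal_scale_restrictDiag (u v : ℂ) (f : Poly) :
    diagonal (scale u v (restrictDiag 0 f)) = diagonal (scale u u f) := by
  have e : (diagonal.comp (scale u v)).comp (restrictDiag 0) = diagonal.comp (scale u u) :=
    MvPolynomial.algHom_ext fun i => by fin_cases i <;> simp [diagonal, restrictDiag]
  exact DFunLike.congr_fun e f

theorem exists_ev (a : ZMod d) (M : Bifact d) : ∃ p : cycles (line (-a) ⊙ line a) (unitObj d),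
    ev a = homMk p ∧ ∀ f g f' g' m, actL M (evenPart {0} (p.1 (el {-a} f g ⊗ₚ el {a} f' g'))) m =
      actL M (scale 1 (etaPow a) f) (actL M (scale (etaPow a) 1 f') m) := by
  obtain ⟨l, hl, l_tmul⟩ := exists_lineTwistL (-a) (line a)
  obtain ⟨z, hz, z_el⟩ := exists_untwist_inv (- -a) 0 (S := {a}) (T := {0}) (by simp [shiftSet])
  rw [ev, psiL_eq, hl, hz, homMk_comp]
  refine ⟨_, rfl, fun f g f' g' m => ?_⟩
  rw [cyclesComp_apply, l_tmul, actL_el, z_el, evenPart_el, map_mul, actL_mul,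
    actL_congr (diagonal_scale_restrictDiag _ _ _), scale_comp, neg_neg, etaPow_mul_etaPow_neg]
  simp

theorem exists_cap (a : ZMod d) (M N : Bifact d) :
    ∃ p : cycles (((line a ⊙ M) ⊙ line (-a)) ⊙ (line a ⊙ (N ⊙ line (-a))))
      ((line a ⊙ (M ⊙ N)) ⊙ line (-a)), cap a M N = homMk p ∧
      ∀ u m f g f' g' n v, p.1 (((u ⊗ₚ m) ⊗ₚ el {-a} f g) ⊗ₚ (el {a} f' g' ⊗ₚ (n ⊗ₚ v))) =
        (u ⊗ₚ (m ⊗ₚ actL N (scale 1 (etaPow a) f) (actL N (scale (etaPow a) 1 f') n))) ⊗ₚ v := by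
  obtain ⟨p₁, h₁, p₁_tmul⟩ :=
    exists_associator (line a ⊙ M) (line (-a)) (line a ⊙ (N ⊙ line (-a)))
  obtain ⟨p₂, h₂, p₂_tmul⟩ := exists_associator_inv (line (-a)) (line a) (N ⊙ line (-a))
  obtain ⟨e, he, e_tmul⟩ := exists_ev a (N ⊙ line (-a))
  obtain ⟨l, hl, l_tmul⟩ := exists_leftUnitor (N ⊙ line (-a))
  obtain ⟨p₃, h₃, p₃_tmul⟩ := exists_associator_inv (line a ⊙ M) N (line (-a))
  obtain ⟨p₄, h₄, p₄_tmul⟩ := exists_associator (line a) M N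
  have contract (f g f' g' : Poly) (n : N) (v : line (-a)) :
      l.1 (e.1 (el {-a} f g ⊗ₚ el {a} f' g') ⊗ₚ (n ⊗ₚ v)) =
        actL N (scale 1 (etaPow a) f) (actL N (scale (etaPow a) 1 f') n) ⊗ₚ v := by
    rw [← actL_tmul, ← actL_tmul, ← e_tmul f g f' g']
    obtain ⟨u, w, h⟩ := exists_el _ (e.1 (el {-a} f g ⊗ₚ el {a} f' g'))
    rw [h, l_tmul, evenPart_el]
  rw [cap, h₁, h₂, he, hl, h₃, h₄]
  simp only [homMk_id, homMk_tensor, homMk_comp]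
  exact ⟨_, rfl, fun u m f g f' g' n v => by
    simp only [cyclesComp_apply, cyclesTensor_tmul, cyclesId_apply, p₁_tmul, p₂_tmul, contract,
      p₃_tmul, p₄_tmul]⟩

theorem cap_comp_sandwich (a : ZMod d) (M N : Bifact d) :
    cap a M N ≫ sandwich a (M ⊙ N) =
      (sandwich a M ⊙ₘ ((associator (line a) N (line (-a))).inv ≫ sandwich a N)) ≫
        (twistTensor (-a) (- -a) (-a) (- -a) (neg_add_cancel _) M N).hom := by
  obtain ⟨c, hc, c_tmul⟩ := exists_cap a M N
  obtain ⟨s, hs, s_tmul⟩ := exists_sandwich a (M ⊙ N)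
  obtain ⟨p, hp, p_tmul⟩ := exists_sandwich a M
  obtain ⟨r, hr, r_tmul⟩ := exists_associator_inv (line a) N (line (-a))
  obtain ⟨q, hq, q_tmul⟩ := exists_sandwich a N
  obtain ⟨t, ht, t_tmul⟩ := exists_twistTensor (-a) (- -a) (-a) (- -a) (neg_add_cancel _) M N
  rw [hc, hs, hp, hr, hq, ht, homMk_comp, homMk_comp, homMk_tensor, homMk_comp]
  refine homMk_congr_tmul fun u v => ?_
  induction u using tensor_induction_left with
  | add s t hs ht => simp only [add_tmul, map_add, hs, ht]
  | tmul w m u =>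
    obtain ⟨f, g, rfl⟩ := exists_el _ w
    obtain ⟨f', g', rfl⟩ := exists_el _ u
    induction v using tensor_induction_right with
    | add s t hs ht => simp only [tmul_add, map_add, hs, ht]
    | tmul u n w =>
      obtain ⟨k, l, rfl⟩ := exists_el _ u
      obtain ⟨k', l', rfl⟩ := exists_el _ w
      simp only [cyclesComp_apply, cyclesTensor_tmul, c_tmul, s_tmul, p_tmul, r_tmul, q_tmul,
        t_tmul, actL_tmul, actR_tmul, actR_tmul_eq_tmul_actL, actL_actR]

theorem conjOutside_comp_sandwich (a : ZMod d) {S S' S'' : Finset (ZMod d)}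
    (f : cycles (permFact S) (permFact S' ⊙ permFact S'')) :
    conjOutside a (homMk f) ≫ sandwich a (permFact S' ⊙ permFact S'') =
      (selfTwist a S).hom ≫ homMk (twistCycle (-a) (- -a) f) := by
  rw [conjOutside, Category.assoc, sandwich_naturality, reassoc_of% conjL_comp_sandwich]

theorem conjLegs_comp_sandwich (a : ZMod d) {S S' S'' : Finset (ZMod d)}
    (φ : permFact S ⟶ permFact S' ⊙ permFact S'') :
    conjLegs a φ ≫ sandwich a (permFact S' ⊙ permFact S'') =
      φ ≫ ((selfTwist a S').hom ⊙ₘ (selfTwist a S'').hom) ≫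
        (twistTensor (-a) (- -a) (-a) (- -a) (neg_add_cancel _) _ _).hom := by
  rw [conjLegs, Category.assoc, Category.assoc, cap_comp_sandwich, reassoc_of% tensorHom_comp,
    conjL_comp_sandwich, conjR_comp_sandwich]

end Sandwich

section ChargeRotation

variable {d : ℕ} {M N : Bifact d}

/-- The endomorphisms which act on the part of charge `q` as `c e^{π i a q}` times the `a`-th power
of the parity operator. -/
def IsChargeRotation (a : ℤ) (c : ℂ) (G : Module.End ℂ M) : Prop :=
  ∀ q m, M.chg m = q • m →
    G m = (c * Complex.exp (Real.pi * Complex.I * a * q)) • (M.par ^ a.natAbs) m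

theorem eq_of_le_of_iSup_eq_top {ι α : Type*} [CompleteLattice α] [IsModularLattice α]
    {s t : ι → α} (hst : ∀ i, s i ≤ t i) (ht : iSupIndep t) (hs : ⨆ i, s i = ⊤) (i : ι) :
    s i = t i := by
  refine eq_of_le_of_inf_le_of_sup_le (z := ⨆ j, ⨆ (_ : j ≠ i), s j) (hst i) ?_ ?_
  · exact ((ht i).mono_right (iSup₂_mono fun j _ => hst j)).eq_bot.trans_le bot_le
  · exact le_top.trans_eq (hs.symm.trans (iSup_split_single s i))

theorem chg_induction {p : M → Prop} (m : M) (eigen : ∀ (q : ℂ) m, M.chg m = q • m → p m)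
    (zero : p 0) (add : ∀ m n, p m → p n → p (m + n)) : p m :=
  Submodule.iSup_induction (motive := p) M.chg.eigenspace
    (M.chg_diagonalisable.symm ▸ Submodule.mem_top)
    (fun q m hm => eigen q m (Module.End.mem_eigenspace_iff.1 hm)) zero add

theorem isChargeRotation_of_span {a : ℤ} {c : ℂ} {G : Module.End ℂ M}
    (hG : Submodule.span ℂ {m | ∃ q, M.chg m = q • m ∧
      G m = (c * Complex.exp (Real.pi * Complex.I * a * q)) • (M.par ^ a.natAbs) m} = ⊤) :
    IsChargeRotation a c G := by
  intro q m hm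
  let rotated (q : ℂ) : Submodule ℂ M := M.chg.eigenspace q ⊓
    LinearMap.eqLocus G ((c * Complex.exp (Real.pi * Complex.I * a * q)) • M.par ^ a.natAbs)
  have iSup_rotated : ⨆ q, rotated q = ⊤ :=
    eq_top_iff.2 <| hG.ge.trans <| Submodule.span_le.2 fun m ⟨q, chg_m, G_m⟩ =>
      Submodule.mem_iSup_of_mem q ⟨Module.End.mem_eigenspace_iff.2 chg_m, G_m⟩
  have e := eq_of_le_of_iSup_eq_top (fun q => inf_le_left) M.chg.eigenspaces_iSupIndep
    iSup_rotated q
  have mem : m ∈ rotated q := e.symm ▸ Module.End.mem_eigenspace_iff.2 hm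
  exact mem.2

theorem par_pow_tmul (k : ℕ) (m : M) (n : N) :
    ((M ⊙ N).par ^ k) (m ⊗ₚ n) = (M.par ^ k) m ⊗ₚ (N.par ^ k) n := by
  induction k generalizing m n with
  | zero => rfl
  | succ k ih => simp only [pow_succ, Module.End.mul_apply, par_tmul, ih]

theorem map_par_pow (f : cycles M N) (k : ℕ) (m : M) :
    f.1 ((M.par ^ k) m) = (N.par ^ k) (f.1 m) := by
  induction k generalizing m with
  | zero => rfl
  | succ k ih => simp only [pow_succ, Module.End.mul_apply, ih, f.2.2.2.1]

theorem IsChargeRotation.tensor {a : ℤ} {c c' : ℂ} {G : Module.End ℂ M} {G' : Module.End ℂ N}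
    (hG : IsChargeRotation a c G) (hG' : IsChargeRotation a c' G')
    {F : Module.End ℂ (M ⊙ N : Bifact d)} (hF : ∀ m n, F (m ⊗ₚ n) = G m ⊗ₚ G' n) :
    IsChargeRotation a (c * c') F := by
  refine isChargeRotation_of_span (Submodule.eq_top_iff'.2 fun t => ?_)
  induction t using tensor_induction with
  | add s t hs ht => exact add_mem hs ht
  | tmul m n =>
    induction m using chg_induction with
    | zero => exact zero_tmul n ▸ zero_mem _
    | add m m' hm hm' => exact add_tmul m m' n ▸ add_mem hm hm'
    | eigen p m hm =>
      induction n using chg_induction with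
      | zero => exact tmul_zero m ▸ zero_mem _
      | add n n' hn hn' => exact tmul_add m n n' ▸ add_mem hn hn'
      | eigen q n hn =>
        refine Submodule.subset_span ⟨p + q, ?_, ?_⟩
        · simp only [chg_tmul, hm, hn, smul_tmul, tmul_smul, add_smul]
        · rw [hF, hG p m hm, hG' q n hn, smul_tmul, tmul_smul, smul_smul, par_pow_tmul,
            mul_mul_mul_comm, ← Complex.exp_add, mul_add]

theorem IsChargeRotation.intertwine {a : ℤ} {r c c' : ℂ} {G : Module.End ℂ M}
    {G' : Module.End ℂ N} (hG : IsChargeRotation a c G) (hG' : IsChargeRotation a c' G')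
    (hr : c = r * c') (f : cycles M N) (m : M) : f.1 (G m) = r • G' (f.1 m) := by
  induction m using chg_induction with
  | zero => simp only [map_zero, smul_zero]
  | add m n hm hn => simp only [map_add, hm, hn, smul_add]
  | eigen q m hm =>
    have chg_map : N.chg (f.1 m) = q • f.1 m := by rw [← f.2.2.2.2.1, hm, map_smul]
    rw [hG q m hm, hG' q _ chg_map, map_smul, map_par_pow, smul_smul, hr, mul_assoc]

theorem scale_monomial (u : ℂ) (m : Fin 2 →₀ ℕ) (c : ℂ) :
    scale u u (MvPolynomial.monomial m c) = u ^ (m 0 + m 1) • MvPolynomial.monomial m c := by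
  rw [MvPolynomial.monomial_eq, Finsupp.prod_fintype _ _ (by simp), Fin.prod_univ_two]
  simp only [Fin.isValue, map_mul, MvPolynomial.algHom_C, MvPolynomial.algebraMap_eq, map_pow,
    scale_X_zero, mul_pow, scale_X_one, pow_add, MvPolynomial.smul_eq_C_mul]
  ring

theorem card_interval (m : ZMod d) {l : ℕ} (hl : l < d) : (interval m l).card = l + 1 := by
  rw [interval, Finset.card_image_of_injOn, Finset.card_range]
  intro i hi j hj h
  have hi' : i < d := (Finset.mem_range_succ_iff.1 hi).trans_lt hl
  have hj' : j < d := (Finset.mem_range_succ_iff.1 hj).trans_lt hl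
  have e := (ZMod.natCast_eq_natCast_iff' i j d).1 (add_left_cancel h)
  rwa [Nat.mod_eq_of_lt hi', Nat.mod_eq_of_lt hj'] at e

theorem exp_int_pi (a : ℤ) : Complex.exp (Real.pi * Complex.I * a) = (-1) ^ a.natAbs := by
  rw [mul_comm, Complex.exp_int_mul, Complex.exp_pi_mul_I]
  obtain ⟨n, rfl | rfl⟩ := Int.eq_nat_or_neg a
  · simp
  · rw [zpow_neg, zpow_natCast, Int.natAbs_neg, Int.natAbs_natCast, ← inv_pow]
    norm_num

variable [NeZero d]

theorem etaPow_intCast_pow (a : ℤ) (n : ℕ) :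
    etaPow (a : ZMod d) ^ n = Complex.exp (Real.pi * Complex.I * a * (2 / d * n)) := by
  rw [etaPow_eq, ← Complex.exp_int_mul, ← Complex.exp_nat_mul]
  congr 1
  field_simp

theorem etaPow_natCast_mul_intCast (a : ℤ) (n : ℕ) :
    etaPow ((n : ZMod d) * (a : ZMod d)) = Complex.exp (Real.pi * Complex.I * a * (2 / d * n)) := by
  rw [← etaPow_intCast_pow, ← AddChar.map_nsmul_eq_pow, nsmul_eq_mul]

variable (S : Finset (ZMod d))

theorem par_pow_el (k : ℕ) (f g : Poly) :
    ((permFact S).par ^ k) (el S f g) = el S f ((-1 : ℂ) ^ k • g) := by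
  induction k generalizing f g with
  | zero => simp
  | succ k ih => simp [pow_succ, ih]

theorem chg_el_monomial_zero (u : Fin 2 →₀ ℕ) (c : ℂ) :
    (permFact S).chg (el S (MvPolynomial.monomial u c) 0) =
      (2 / d * ↑(u 0 + u 1) + (1 - S.card) / d : ℂ) • el S (MvPolynomial.monomial u c) 0 := by
  simp only [chg_el, euler_monomial, smul_el, smul_smul, ← add_smul, map_zero, smul_zero, add_zero]

theorem chg_el_zero_monomial (u : Fin 2 →₀ ℕ) (c : ℂ) :
    (permFact S).chg (el S 0 (MvPolynomial.monomial u c)) =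
      (2 / d * ↑(u 0 + u 1) + ((S.card + 1) / d - 1) : ℂ) •
        el S 0 (MvPolynomial.monomial u c) := by
  simp only [chg_el, euler_monomial, smul_el, smul_smul, ← add_smul, map_zero, smul_zero, add_zero]

theorem el_monomial_induction {p : permFact S → Prop} (t : permFact S)
    (even : ∀ u c, p (el S (MvPolynomial.monomial u c) 0))
    (odd : ∀ u c, p (el S 0 (MvPolynomial.monomial u c)))
    (add : ∀ s t, p s → p t → p (s + t)) : p t := by
  obtain ⟨f, g, rfl⟩ := exists_el S t
  rw [show el S f g = el S f 0 + el S 0 g by rw [add_el, add_zero, zero_add]]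
  refine add _ _ ?_ ?_
  · induction f using MvPolynomial.induction_on' with
    | monomial u c => exact even u c
    | add f f' hf hf' => simpa only [add_el, add_zero] using add _ _ hf hf'
  · induction g using MvPolynomial.induction_on' with
    | monomial u c => exact odd u c
    | add g g' hg hg' => simpa only [add_el, add_zero] using add _ _ hg hg'

theorem isChargeRotation_rotate (a : ℤ) {G : Module.End ℂ (permFact S)}
    (hG : ∀ f g, G (el S f g) = el S (scale (etaPow (a : ZMod d)) (etaPow (a : ZMod d)) f)
      (etaPow ((S.card : ZMod d) * (a : ZMod d)) •
        scale (etaPow (a : ZMod d)) (etaPow (a : ZMod d)) g)) :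
    IsChargeRotation a (Complex.exp (Real.pi * Complex.I * a * ((S.card - 1) / d))) G := by
  refine isChargeRotation_of_span (Submodule.eq_top_iff'.2 fun t => ?_)
  induction t using el_monomial_induction with
  | add s t hs ht => exact add_mem hs ht
  | even u c =>
    refine Submodule.subset_span ⟨_, chg_el_monomial_zero S u c, ?_⟩
    simp only [hG, scale_monomial, map_zero, smul_zero, par_pow_el, smul_el, etaPow_intCast_pow,
      ← Complex.exp_add]
    congr 3
    ring
  | odd u c =>
    refine Submodule.subset_span ⟨_, chg_el_zero_monomial S u c, ?_⟩
    simp only [hG, scale_monomial, map_zero, smul_zero, par_pow_el, smul_el, smul_smul,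
      etaPow_intCast_pow, etaPow_natCast_mul_intCast, ← exp_int_pi, ← Complex.exp_add]
    congr 3
    ring

theorem exists_selfTwist (a : ℤ) :
    ∃ p : cycles (permFact S) (twist (-(a : ZMod d)) (- -(a : ZMod d)) (permFact S)),
      (selfTwist (a : ZMod d) S).hom = homMk p ∧
      IsChargeRotation a (Complex.exp (Real.pi * Complex.I * a * ((S.card - 1) / d)))
        (ofTwist _ _ _ ∘ₗ p.1) := by
  obtain ⟨p, hp, p_el⟩ := exists_untwist (-(a : ZMod d)) (- -(a : ZMod d)) (S := S) (T := S)
    (by simp [shiftSet])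
  refine ⟨p, hp, isChargeRotation_rotate S a fun f g => ?_⟩
  rw [LinearMap.comp_apply, p_el, ofTwist_toTwist, neg_neg, mul_neg, neg_neg]

theorem exists_selfTwist_tensor (a : ℤ) (S' : Finset (ZMod d)) :
    ∃ p : cycles (permFact S ⊙ permFact S')
        (twist (-(a : ZMod d)) (- -(a : ZMod d)) (permFact S ⊙ permFact S')),
      ((selfTwist (a : ZMod d) S).hom ⊙ₘ (selfTwist (a : ZMod d) S').hom) ≫
        (twistTensor _ _ _ _ (neg_add_cancel _) _ _).hom = homMk p ∧
      IsChargeRotation a (Complex.exp (Real.pi * Complex.I * a * ((S.card - 1) / d)) *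
        Complex.exp (Real.pi * Complex.I * a * ((S'.card - 1) / d))) (ofTwist _ _ _ ∘ₗ p.1) := by
  obtain ⟨p, hp, rotation_p⟩ := exists_selfTwist S a
  obtain ⟨q, hq, rotation_q⟩ := exists_selfTwist S' a
  obtain ⟨t, ht, t_tmul⟩ := exists_twistTensor (-(a : ZMod d)) (- -(a : ZMod d)) (-(a : ZMod d))
    (- -(a : ZMod d)) (neg_add_cancel _) (permFact S) (permFact S')
  rw [hp, hq, ht, homMk_tensor, homMk_comp]
  refine ⟨_, rfl, rotation_p.tensor rotation_q fun m n => ?_⟩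
  obtain ⟨m', hm⟩ := exists_toTwist _ _ _ (p.1 m)
  obtain ⟨n', hn⟩ := exists_toTwist _ _ _ (q.1 n)
  simp only [LinearMap.comp_apply, cyclesComp_apply, cyclesTensor_tmul, hm, hn, t_tmul,
    ofTwist_toTwist]

theorem selfTwist_comp_twistCycle (a : ℤ) {S S' S'' : Finset (ZMod d)}
    (f : cycles (permFact S) (permFact S' ⊙ permFact S'')) :
    (selfTwist (a : ZMod d) S).hom ≫ homMk (twistCycle (-(a : ZMod d)) (- -(a : ZMod d)) f) =
      Complex.exp (Real.pi * Complex.I * a *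
        (((S.card - 1) - (S'.card - 1) - (S''.card - 1)) / d)) •
        (homMk f ≫ ((selfTwist (a : ZMod d) S').hom ⊙ₘ (selfTwist (a : ZMod d) S'').hom) ≫
          (twistTensor _ _ _ _ (neg_add_cancel _) _ _).hom) := by
  obtain ⟨p, hp, rotation_p⟩ := exists_selfTwist S a
  obtain ⟨q, hq, rotation_q⟩ := exists_selfTwist_tensor S' a S''
  rw [hp, hq, homMk_comp, homMk_comp, homMk_smul]
  refine homMk_congr fun m =>
    congrArg (toTwist (-(a : ZMod d)) (- -(a : ZMod d)) _)
      (rotation_p.intertwine rotation_q ?_ f m)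
  rw [← Complex.exp_add, ← Complex.exp_add]
  congr 1
  ring

end ChargeRotation

end

end LandauGinzburg

theorem proposition3_general {d : ℕ} [NeZero d] (a : ℤ) {S S' S'' : Finset (ZMod d)}
    (φ : permFact S ⟶ permFact S' ⊙ permFact S'') :
    conjOutside (a : ZMod d) φ = Complex.exp (2 * Real.pi * Complex.I / d *
      ((a : ℂ) / 2 * ((S.card : ℂ) - S'.card - S''.card + 1))) • conjLegs (a : ZMod d) φ := by
  obtain ⟨f, rfl⟩ := exists_homMk φ
  rw [← cancel_mono (sandwich (a : ZMod d) (permFact S' ⊙ permFact S'')), smul_comp_eq,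
    conjOutside_comp_sandwich, conjLegs_comp_sandwich, selfTwist_comp_twistCycle]
  congr 2
  ring

theorem proposition3 (d : ℕ) [NeZero d] (hd : 2 ≤ d) :
    ∃ (_ : ∀ (a : ZMod d) (S T : Finset (ZMod d)) (h : T = shiftSet S a), IsIso (psiL a h))
      (_ : ∀ (a : ZMod d) (S T : Finset (ZMod d)) (h : T = shiftSet S a), IsIso (psiR a h)),
      ∀ (a : ℤ) (m m' m'' : ZMod d) (l l' l'' : ℕ), l + 2 ≤ d → l' + 2 ≤ d → l'' + 2 ≤ d →
        ∀ φ : permInterval m l ⟶ permInterval m' l' ⊙ permInterval m'' l'',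
          conjOutside (a : ZMod d) φ =
            Complex.exp (2 * Real.pi * Complex.I / d *
              ((a : ℂ) / 2 * ((l : ℂ) - (l' : ℂ) - (l'' : ℂ)))) •
              conjLegs (a : ZMod d) φ := by
  refine ⟨fun a S T h => isIso_psiL a h, fun a S T h => isIso_psiR a h, ?_⟩
  intro a m m' m'' l l' l'' hl hl' hl'' φ
  rw [proposition3_general, card_interval m (by lia), card_interval m' (by lia),
    card_interval m'' (by lia)]
  congr 4
  push_cast
  ring
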